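/- Let $d\ge 1$, let $\mathbb T^d_N=(\mathbb Z/N\mathbb Z)^d$ be the discrete torus with its nearest neighbor graph structure and graph distance $|x-y|$, and let $\pi\equiv N^{-d}$ be the uniform distribution on it. Let $(\eta_t)_{t\ge0}$ be the averaging process on $\mathbb T^d_N$ started from the unit mass $\mathbf 1_0$ at the origin, that is, the Markov jump process on the space $\mathcal P(\mathbb T^d_N)$ of probability mass functions on $\mathbb T^d_N$ with generator $$\mathcal L f(\eta)=\frac12\sum_{x\in\mathbb T^d_N}\ \sum_{y:\,|x-y|=1}\big(f(\eta^{xy})-f(\eta)\big),\qquad f\in\mathcal C(\mathcal P(\mathbb T^d_N)),$$ where $\eta^{xy}$ is obtained from $\eta$ by replacing both masses $\eta(x)$ and $\eta(y)$ with $\frac12(\eta(x)+\eta(y))$. Let $\pi_t(x)=\mathbf P(X_t=x)$, where $(X_t)_{t\ge0}$ is the continuous-time random walk on $\mathbb T^d_N$ started from $0$, with generator $L\psi(x)=\frac12\sum_{y:\,|x-y|=1}(\psi(y)-\psi(x))$. For $\psi:\mathbb T^d_N\to\mathbb R$, define the Dirichlet form $$\mathcal E(\psi)=\frac1{4N^d}\sum_{x\in\mathbb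 T^d_N}\ \sum_{y:\,|x-y|=1}\big(\psi(x)-\psi(y)\big)^2 .$$ Then, for every $d\ge1$, there exist constants $B,C_1,C_2>0$ depending only on $d$ such that, for all $N\in\mathbb N$ large enough (depending only on $d$) and for all $t\ge 0$, $$\big(1+C_1(t\wedge 1)\big)\,\mathcal E\Big(\frac{\pi_t}{\pi}\Big)\ \le\ \mathbb E\Big[\mathcal E\Big(\frac{\eta_t}{\pi}\Big)\Big]\ \le\ C_2\exp\Big(\frac{Bt}{N^{d+2}}\Big)\,\mathcal E\Big(\frac{\pi_t}{\pi}\Big).$$ -/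

import Mathlib

open MeasureTheory Filter Topology
open scoped NNReal

noncomputable section

/-- The vertex set of the discrete `d`-dimensional torus of size `N`. -/
abbrev Torus (d N : ℕ) : Type := Fin d → ZMod N

/-- The nearest neighbor graph on the torus: two vertices are adjacent iff they are distinct and
differ by `± 1` in exactly one coordinate. -/
def torusGraph (d N : ℕ) : SimpleGraph (Torus d N) :=
  SimpleGraph.fromRel fun x y => ∃ i : Fin d, y = x + Pi.single i 1

/-- The space of probability mass functions on the torus, as a compact subset of `ℝ ^ Torus`. -/
abbrev MassSpace (d N : ℕ) [NeZero N] : Type := stdSimplex ℝ (Torus d N)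

/-! ### Markov jump processes with a bounded generator on a compact space -/

/-- The semigroup `t ↦ exp (t G)` generated by the bounded operator `G` on a normed space. -/
def semigroupOf {F : Type*} [NormedAddCommGroup F] [NormedSpace ℝ F]
    (G : F →L[ℝ] F) (t : ℝ≥0) : F →L[ℝ] F :=
  NormedSpace.exp ((t : ℝ) • G)

/-- The `σ`-algebra generated by the process `Y` up to time `s`. -/
@[reducible]
def pastOf {E Ω : Type*} [MeasurableSpace E] (Y : ℝ≥0 → Ω → E) (s : ℝ≥0) : MeasurableSpace Ω :=
  ⨆ r ≤ s, MeasurableSpace.comap (Y r) inferInstance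

/-- `Y` is, under `P`, a Markov jump process on `E` with infinitesimal generator `G`,
started from `ξ`. -/
structure IsMarkovJumpProcess {E : Type*} [TopologicalSpace E] [CompactSpace E]
    [MeasurableSpace E] (G : C(E, ℝ) →L[ℝ] C(E, ℝ)) (ξ : E)
    {Ω : Type*} [MeasurableSpace Ω] (P : Measure Ω) (Y : ℝ≥0 → Ω → E) : Prop where
  /-- each `Y t` is a random variable -/
  measurable : ∀ t, Measurable (Y t)
  /-- the process starts from `ξ` -/
  start : ∀ᵐ ω ∂P, Y 0 ω = ξ
  /-- the paths are right-continuous step functions with finitely many jumps in bounded times -/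
  paths : ∀ᵐ ω ∂P, ∀ t, (∀ᶠ s in 𝓝[>] t, Y s ω = Y t ω) ∧ ∃ x, ∀ᶠ s in 𝓝[<] t, Y s ω = x
  /-- Markov property, with the semigroup generated by `G` as transition semigroup -/
  markov : ∀ (s t : ℝ≥0) (f : C(E, ℝ)),
    P[fun ω => f (Y (s + t) ω) | pastOf Y s] =ᵐ[P] fun ω => semigroupOf G t f (Y s ω)

/-! ### The averaging process -/

/-- The mass function obtained from `η` by replacing the masses at `x` and `y` by their average. -/
def avgFun {V : Type*} [DecidableEq V] (x y : V) (η : V → ℝ) : V → ℝ :=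
  fun z => if z = x ∨ z = y then (η x + η y) / 2 else η z

theorem avgFun_eq {V : Type*} [DecidableEq V] (x y : V) (η : V → ℝ) :
    avgFun x y η = fun z => (η z + η (Equiv.swap x y z)) / 2 := by
  funext z
  unfold avgFun
  by_cases hx : z = x
  · subst hx; simp
  · by_cases hy : z = y
    · subst hy; simp [add_comm]
    · simp [hx, hy, Equiv.swap_apply_of_ne_of_ne hx hy]

theorem avgFun_mem {V : Type*} [DecidableEq V] [Fintype V] (x y : V) {η : V → ℝ}
    (h : η ∈ stdSimplex ℝ V) : avgFun x y η ∈ stdSimplex ℝ V := by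
  rw [avgFun_eq]
  refine ⟨fun z => ?_, ?_⟩
  · have h1 := h.1 z
    have h2 := h.1 (Equiv.swap x y z)
    show 0 ≤ (η z + η (Equiv.swap x y z)) / 2
    linarith
  · rw [← Finset.sum_div, Finset.sum_add_distrib, Equiv.sum_comp (Equiv.swap x y) η, h.2]
    norm_num

/-- The averaging update `η ↦ η^{xy}` as a continuous self-map of the space of mass functions. -/
def avgMap {d N : ℕ} [NeZero N] (x y : Torus d N) : C(MassSpace d N, MassSpace d N) where
  toFun η := ⟨avgFun x y η.1, avgFun_mem x y η.2⟩
  continuous_toFun := by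
    refine Continuous.subtype_mk (continuous_pi fun z => ?_) _
    simp only [avgFun_eq]
    have h : ∀ w : Torus d N, Continuous fun η : MassSpace d N => η.1 w :=
      fun w => (continuous_apply w).comp continuous_subtype_val
    exact ((h z).add (h _)).div_const 2

open Classical in
/-- The generator of the averaging process,
`f ↦ (1/2) ∑_x ∑_{y ∼ x} (f (η^{xy}) - f η)`, on continuous functions. -/
def avgGenerator (d N : ℕ) [NeZero N] :
    C(MassSpace d N, ℝ) →L[ℝ] C(MassSpace d N, ℝ) :=
  (1 / 2 : ℝ) • ∑ x : Torus d N, ∑ y : Torus d N with (torusGraph d N).Adj x y,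
    (ContinuousMap.compCLM ℝ ℝ (avgMap x y) - ContinuousLinearMap.id ℝ _)

open Classical in
theorem avgGenerator_apply (d N : ℕ) [NeZero N] (f : C(MassSpace d N, ℝ)) (η : MassSpace d N) :
    avgGenerator d N f η = (1 / 2 : ℝ) * ∑ x : Torus d N,
      ∑ y : Torus d N with (torusGraph d N).Adj x y, (f (avgMap x y η) - f η) := by
  simp [avgGenerator]

/-- The averaging process on the torus started from the unit mass at the origin. -/
def IsAveragingProcess (d N : ℕ) [NeZero N] {Ω : Type*} [MeasurableSpace Ω] (P : Measure Ω)
    (η : ℝ≥0 → Ω → MassSpace d N) : Prop :=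
  IsMarkovJumpProcess (avgGenerator d N) (stdSimplex.vertex (0 : Torus d N)) P η

/-! ### The random walk -/

open Classical in
/-- The generator of the lazy simple random walk on the torus,
`ψ ↦ (1/2) ∑_{y ∼ x} (ψ y - ψ x)`. -/
def rwGenerator (d N : ℕ) [NeZero N] : C(Torus d N, ℝ) →L[ℝ] C(Torus d N, ℝ) :=
  haveI : FiniteDimensional ℝ C(Torus d N, ℝ) :=
    Module.Finite.of_injective (ContinuousMap.coeFnLinearMap ℝ (M := ℝ) (α := Torus d N))
      DFunLike.coe_injective
  LinearMap.toContinuousLinearMap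
    { toFun := fun ψ =>
        ⟨fun x => (1 / 2 : ℝ) * ∑ y : Torus d N with (torusGraph d N).Adj x y, (ψ y - ψ x),
          continuous_of_discreteTopology⟩
      map_add' := fun ψ φ => by
        ext x
        simp only [ContinuousMap.coe_mk, ContinuousMap.add_apply, ← mul_add,
          ← Finset.sum_add_distrib]
        congr 1
        exact Finset.sum_congr rfl fun y _ => by ring
      map_smul' := fun c ψ => by
        ext x
        simp only [ContinuousMap.coe_mk, ContinuousMap.smul_apply, smul_eq_mul, RingHom.id_apply,
          Finset.mul_sum]
        exact Finset.sum_congr rfl fun y _ => by ring }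

open Classical in
theorem rwGenerator_apply (d N : ℕ) [NeZero N] (ψ : C(Torus d N, ℝ)) (x : Torus d N) :
    rwGenerator d N ψ x =
      (1 / 2 : ℝ) * ∑ y : Torus d N with (torusGraph d N).Adj x y, (ψ y - ψ x) :=
  rfl

/-- The lazy continuous-time simple random walk on the torus started from the origin. -/
def IsRandomWalk (d N : ℕ) [NeZero N] {Ω : Type*} [MeasurableSpace Ω] (P : Measure Ω)
    (X : ℝ≥0 → Ω → Torus d N) : Prop :=
  IsMarkovJumpProcess (rwGenerator d N) 0 P X

/-! ### The Dirichlet form -/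

open Classical in
/-- The Dirichlet form `(1 / (4 N^d)) ∑_x ∑_{y ∼ x} (ψ x - ψ y)²`. -/
def dirichletForm {d N : ℕ} [NeZero N] (ψ : Torus d N → ℝ) : ℝ :=
  1 / (4 * (N : ℝ) ^ d) *
    ∑ x : Torus d N, ∑ y : Torus d N with (torusGraph d N).Adj x y, (ψ x - ψ y) ^ 2

/-- The uniform distribution on the torus. -/
def unif (d N : ℕ) (_ : Torus d N) : ℝ := 1 / (N : ℝ) ^ d

end

/-! The autocorrelation `z ↦ ∑ x, η x * η (x + z)` carries everything. The energy of `η / π` is `N ^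
d` times the sum over directions of its value at `0` minus its value at a unit vector, and the
averaging generator sends autocorrelations to linear combinations of autocorrelations
(`avgGenerator_autocorrMap`). So the mean autocorrelation solves the heat equation on the torus with
a source at `0` and its neighbors, proportional to the energy in each direction. The autocorrelation
of the law of the walk solves the same equation without source.

Duhamel's formula and the symmetry between coordinates reduce this to a scalar renewal equation
(`meanEnergy_renewal`), `g t = h t + 1/2 * ∫ s in 0..t, q s * g (t - s)` with `q = -h'`, where `g`
and `h` are the energies of the averaging process and of the walk divided by `d * N ^ d`, so that `h
0 = 1`. The kernel `q / 2` has mass at most `1/2`.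

Lower bound: `g ≥ h` and `h` decreases, so `g ≥ (1 + (1 - h) / 2) * h`, and `1 - h t` is at least a
multiple of `min t 1`.

Upper bound: if the convolution of `q` with `h` were at most `3/2 * h`, then `S = sup g / h` would
satisfy `S ≤ 1 + 3/4 * S`. For large times this holds up to a tilt `exp (-ε s)`. Up to time `N ^ 2`,
`h` is doubling (`decayProfile_half_le`), so the mass of the convolution sits near `s = 0`. Beyond
it, the spectral gap gives `h s * h u ≤ C / N ^ (d + 2) * h (s + u)`; integrated over a long range
of `s` this is affordable only after the tilt, with `ε` of order `N ^ (-(d + 2))`. The tilt is the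
source of the exponential factor in the theorem. -/

/-! ### Renewal inequalities for a decreasing profile -/

theorem le_exp_mul_of_neg_deriv_le {h q : ℝ → ℝ} {ρ u v : ℝ}
    (hq : ∀ t, HasDerivAt h (-q t) t) (huv : u ≤ v)
    (hρ : ∀ t, u ≤ t → t ≤ v → q t ≤ ρ * h t) :
    h u ≤ Real.exp (ρ * (v - u)) * h v := by
  have hd : ∀ t, HasDerivAt (fun x => Real.exp (ρ * x) * h x)
      (Real.exp (ρ * t) * (ρ * h t - q t)) t := by
    intro t
    have h1 : HasDerivAt (fun x => Real.exp (ρ * x)) (Real.exp (ρ * t) * (ρ * 1)) t :=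
      ((hasDerivAt_id t).const_mul ρ).exp
    exact (h1.mul (hq t)).congr_deriv (by ring)
  have hm : MonotoneOn (fun x => Real.exp (ρ * x) * h x) (Set.Icc u v) := by
    refine monotoneOn_of_deriv_nonneg (convex_Icc u v)
      (fun t _ => (hd t).continuousAt.continuousWithinAt)
      (fun t _ => (hd t).differentiableAt.differentiableWithinAt) fun t ht => ?_
    rw [interior_Icc] at ht
    rw [(hd t).deriv]
    exact mul_nonneg (Real.exp_pos _).le (sub_nonneg.2 (hρ t ht.1.le ht.2.le))
  have h2 := hm (Set.left_mem_Icc.2 huv) (Set.right_mem_Icc.2 huv) huv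
  have h3 : Real.exp (ρ * (v - u)) * Real.exp (ρ * u) = Real.exp (ρ * v) := by
    rw [← Real.exp_add]; ring_nf
  have h4 : Real.exp (ρ * u) * h u ≤ Real.exp (ρ * u) * (Real.exp (ρ * (v - u)) * h v) := by
    calc _ ≤ Real.exp (ρ * v) * h v := h2
      _ = _ := by rw [← h3]; ring
  exact le_of_mul_le_mul_left h4 (Real.exp_pos _)

theorem integral_neg_deriv {h q : ℝ → ℝ} (hq : ∀ t, HasDerivAt h (-q t) t) (qc : Continuous q)
    (a b : ℝ) : ∫ s in a..b, q s = h a - h b := by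
  have := intervalIntegral.integral_eq_sub_of_hasDerivAt (a := a) (b := b) (f := fun s => -h s)
    (f' := q) (fun x _ => ((hq x).neg).congr_deriv (by simp)) (qc.intervalIntegrable _ _)
  rw [this]; ring

theorem antitone_of_neg_deriv_nonneg {h q : ℝ → ℝ} (hq : ∀ t, HasDerivAt h (-q t) t)
    (q0 : ∀ t, 0 ≤ q t) : Antitone h :=
  antitone_of_deriv_nonpos (fun t => (hq t).differentiableAt) fun t => by
    rw [(hq t).deriv]; simpa using q0 t

theorem tilted_convolution_le {h q : ℝ → ℝ} {R M Λ K ε t : ℝ}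
    (hq : ∀ t, HasDerivAt h (-q t) t) (qc : Continuous q) (q0 : ∀ t, 0 ≤ q t)
    (hpos : ∀ t, 0 < h t) (h0 : h 0 = 1) (hint : ∀ t, 0 ≤ t → ∫ s in (0 : ℝ)..t, h s ≤ 1)
    (qR : ∀ t, 0 < t → q t ≤ R / min t M * h t) (qL : ∀ t, q t ≤ Λ * h t)
    (hmul : ∀ s u, M ≤ s → M ≤ u → h s * h u ≤ K * h (s + u))
    (hR : 1 ≤ R) (hΛ : 0 ≤ Λ) (hε : 0 < ε) (hεK : 12 * (Λ * K) ≤ ε)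
    (ht : 60 * R * Real.exp R ≤ min (t / 2) M) :
    ∫ s in (0 : ℝ)..t, q s * Real.exp (-(ε * s)) * h (t - s) ≤ 3 / 2 * h t := by
  have hanti := antitone_of_neg_deriv_nonneg hq q0
  have hc : Continuous h := continuous_iff_continuousAt.2 fun t => (hq t).continuousAt
  -- The integral is cut at `a`, `b` and `t - b`. The first piece costs `5/4`, the other three
  -- `1/12` each, in total `3/2`.
  set b := min (t / 2) M with hb
  set a := 12 * Real.exp R with ha
  have eR : 1 ≤ Real.exp R := Real.one_le_exp (by linarith)
  have hab : 5 * (a * R) ≤ b := by rw [ha]; linarith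
  have ha0 : 0 < a := by positivity
  have hab' : a ≤ b := by nlinarith
  have hb0 : 0 < b := by linarith
  have hbt : b ≤ t / 2 := min_le_left _ _
  have hbM : b ≤ M := min_le_right _ _
  have hRb : ∀ u, b ≤ u → q u ≤ R / b * h u := by
    intro u hu
    have hu0 : 0 < u := by linarith
    refine (qR u hu0).trans ?_
    have := hpos u
    have h2 : b ≤ min u M := le_min hu hbM
    gcongr
  have hback : ∀ s, 0 ≤ s → s ≤ t - b → h (t - s) ≤ Real.exp (R / b * s) * h t := by
    intro s hs0 hs
    have := le_exp_mul_of_neg_deriv_le (u := t - s) (v := t) (ρ := R / b) hq (by linarith)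
      (fun x hx _ => hRb x (by linarith))
    simpa using this
  have hexp1 : ∀ s, 0 ≤ s → Real.exp (-(ε * s)) ≤ 1 := by
    intro s hs
    rw [Real.exp_le_one_iff]
    have := mul_nonneg hε.le hs
    linarith
  have hf : Continuous fun s => q s * Real.exp (-(ε * s)) * h (t - s) := by fun_prop
  have hii : ∀ x y, IntervalIntegrable (fun s => q s * Real.exp (-(ε * s)) * h (t - s))
      volume x y := fun x y => hf.intervalIntegrable x y
  have hle : ∀ s, 0 ≤ s → q s * Real.exp (-(ε * s)) * h (t - s) ≤ q s * h (t - s) := by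
    intro s hs
    have := hexp1 s hs
    have := q0 s
    have := (hpos (t - s)).le
    have h3 : q s * Real.exp (-(ε * s)) ≤ q s := by nlinarith
    gcongr
  have ht0 := hpos t
  have I1 : ∫ s in (0 : ℝ)..a, q s * Real.exp (-(ε * s)) * h (t - s) ≤ 5 / 4 * h t := by
    have h1 : ∫ s in (0 : ℝ)..a, q s * Real.exp (-(ε * s)) * h (t - s) ≤
        ∫ s in (0 : ℝ)..a, q s * (5 / 4 * h t) := by
      refine intervalIntegral.integral_mono_on ha0.le (hii _ _)
        ((qc.mul continuous_const).intervalIntegrable _ _) fun s hs => ?_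
      refine (hle s hs.1).trans (mul_le_mul_of_nonneg_left ?_ (q0 s))
      refine (hback s hs.1 (by linarith [hs.2])).trans ?_
      -- On `[0, a]` the exponent is at most `R * a / b ≤ 1/5`, so `h (t - s)` is nearly `h t`.
      have h2 : Real.exp (R / b * s) ≤ 5 / 4 := by
        have h3 : R / b * s ≤ 1 / 5 := by
          rw [div_mul_eq_mul_div, div_le_iff₀ hb0]
          nlinarith [hs.2]
        have h4 := Real.exp_bound' (x := 1 / 5) (by norm_num) (by norm_num) (n := 3) (by norm_num)
        refine (Real.exp_le_exp.2 h3).trans (h4.trans ?_)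
        norm_num [Finset.sum_range_succ, Nat.factorial]
      gcongr
    refine h1.trans ?_
    rw [intervalIntegral.integral_mul_const, integral_neg_deriv hq qc, h0]
    have := (hpos a).le
    nlinarith
  -- A decreasing function of integral at most `1`; with `a = 12 * exp R` this pays for the loss
  -- `exp R` on `[a, b]`.
  have hha : h a ≤ 1 / a := by
    have h1 : ∫ s in (0 : ℝ)..a, h a ≤ ∫ s in (0 : ℝ)..a, h s :=
      intervalIntegral.integral_mono_on ha0.le (by simp) (hc.intervalIntegrable _ _)
        fun s hs => hanti hs.2
    rw [intervalIntegral.integral_const, smul_eq_mul, sub_zero] at h1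
    rw [le_div_iff₀ ha0]
    have := hint a ha0.le
    linarith
  have hbackR : ∀ s, 0 ≤ s → s ≤ b → h (t - s) ≤ Real.exp R * h t := by
    intro s hs0 hs
    refine (hback s hs0 (by linarith)).trans ?_
    have h3 : R / b * s ≤ R := by
      rw [div_mul_eq_mul_div, div_le_iff₀ hb0]
      nlinarith
    gcongr
  have I2 : ∫ s in a..b, q s * Real.exp (-(ε * s)) * h (t - s) ≤ 1 / 12 * h t := by
    have h1 : ∫ s in a..b, q s * Real.exp (-(ε * s)) * h (t - s) ≤
        ∫ s in a..b, q s * (Real.exp R * h t) := by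
      refine intervalIntegral.integral_mono_on hab' (hii _ _)
        ((qc.mul continuous_const).intervalIntegrable _ _) fun s hs => ?_
      have hs0 : 0 ≤ s := by linarith [hs.1]
      exact (hle s hs0).trans (mul_le_mul_of_nonneg_left (hbackR s hs0 hs.2) (q0 s))
    refine h1.trans ?_
    rw [intervalIntegral.integral_mul_const, integral_neg_deriv hq qc]
    have h2 := (hpos b).le
    have h3 : h a * Real.exp R ≤ 1 / 12 := by
      refine (mul_le_mul_of_nonneg_right hha (Real.exp_pos R).le).trans ?_
      rw [ha]
      field_simp
      exact le_refl _
    have h4 : (h a - h b) * Real.exp R ≤ 1 / 12 := by nlinarith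
    calc (h a - h b) * (Real.exp R * h t) = ((h a - h b) * Real.exp R) * h t := by ring
      _ ≤ _ := by gcongr
  have I3 : ∫ s in b..(t - b), q s * Real.exp (-(ε * s)) * h (t - s) ≤ 1 / 12 * h t := by
    rcases (show b ≤ t - b by linarith).eq_or_lt with hbb | hbb
    · rw [← hbb, intervalIntegral.integral_same]
      positivity
    -- If `b = t / 2` the middle range is a point; otherwise both `s` and `t - s` exceed `M` and
    -- `hmul` applies.
    have hbM' : b = M := by
      rcases min_choice (t / 2) M with h' | h'
      · rw [← hb] at h'; linarith
      · exact h'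
    have h1 : ∫ s in b..(t - b), q s * Real.exp (-(ε * s)) * h (t - s) ≤
        ∫ s in b..(t - b), (Λ * K * h t) * Real.exp (-(ε * s)) := by
      refine intervalIntegral.integral_mono_on hbb.le (hii _ _)
        ((by fun_prop : Continuous fun s => (Λ * K * h t) * Real.exp (-(ε * s))).intervalIntegrable
          _ _) fun s hs => ?_
      have h2 := hmul s (t - s) (by linarith [hs.1]) (by linarith [hs.2])
      rw [add_sub_cancel] at h2
      have h3 : q s * h (t - s) ≤ Λ * K * h t := by
        have := mul_le_mul_of_nonneg_right (qL s) (hpos (t - s)).le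
        nlinarith
      have := (Real.exp_pos (-(ε * s))).le
      nlinarith
    refine h1.trans ?_
    have hK : 0 ≤ K := by
      have h2 := hmul M M le_rfl le_rfl
      by_contra hK
      have := mul_pos (hpos M) (hpos M)
      have := hpos (M + M)
      nlinarith
    rw [intervalIntegral.integral_const_mul]
    have h4 : ∫ s in b..(t - b), Real.exp (-(ε * s)) =
        (Real.exp (-(ε * b)) - Real.exp (-(ε * (t - b)))) / ε := by
      have := intervalIntegral.integral_eq_sub_of_hasDerivAt (a := b) (b := t - b)
        (f := fun s => -(Real.exp (-(ε * s)) / ε))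
        (f' := fun s => Real.exp (-(ε * s))) (fun x _ => by
          have h5 : HasDerivAt (fun x => -(ε * x)) (-(ε * 1)) x :=
            ((hasDerivAt_id x).const_mul ε).neg
          refine ((h5.exp.div_const ε).neg).congr_deriv ?_
          field_simp) (by
          exact (by fun_prop : Continuous fun s => Real.exp (-(ε * s))).intervalIntegrable _ _)
      rw [this]; ring
    rw [h4]
    have h5 : (Real.exp (-(ε * b)) - Real.exp (-(ε * (t - b)))) / ε ≤ 1 / ε := by
      have h6 := hexp1 b hb0.le
      have h7 := (Real.exp_pos (-(ε * (t - b)))).le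
      gcongr
      linarith
    have h8 : 0 ≤ Λ * K * h t := by positivity
    refine (mul_le_mul_of_nonneg_left h5 h8).trans ?_
    rw [mul_one_div, div_le_iff₀ hε]
    nlinarith
  have I4 : ∫ s in (t - b)..t, q s * Real.exp (-(ε * s)) * h (t - s) ≤ 1 / 12 * h t := by
    have h1 : ∫ s in (t - b)..t, q s * Real.exp (-(ε * s)) * h (t - s) ≤
        ∫ s in (t - b)..t, (R / b * (Real.exp R * h t)) * h (t - s) := by
      refine intervalIntegral.integral_mono_on (by linarith) (hii _ _)
        ((by fun_prop : Continuous fun s => (R / b * (Real.exp R * h t)) *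
          h (t - s)).intervalIntegrable _ _) fun s hs => ?_
      refine (hle s (by linarith [hs.1])).trans (mul_le_mul_of_nonneg_right ?_ (hpos _).le)
      refine (hRb s (by linarith [hs.1])).trans ?_
      -- Near `s = t` the small factor is `q s ≤ R / b * h s`, while `h (t - s)` has integral at
      -- most `1`.
      have h2 : h s ≤ Real.exp R * h t := (hanti hs.1).trans (hbackR b hb0.le le_rfl)
      gcongr
    refine h1.trans ?_
    rw [intervalIntegral.integral_const_mul, intervalIntegral.integral_comp_sub_left h t]
    simp only [sub_self, sub_sub_cancel]
    have h2 := hint b hb0.le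
    have h3 : 0 ≤ R / b * (Real.exp R * h t) := by positivity
    refine (mul_le_mul_of_nonneg_left h2 h3).trans ?_
    have h4 : R / b * Real.exp R ≤ 1 / 12 := by
      rw [div_mul_eq_mul_div, div_le_iff₀ hb0]
      have : 0 ≤ R * Real.exp R := by positivity
      nlinarith
    calc _ = (R / b * Real.exp R) * h t := by ring
      _ ≤ _ := by gcongr
  rw [← intervalIntegral.integral_add_adjacent_intervals (hii 0 a) (hii a t),
    ← intervalIntegral.integral_add_adjacent_intervals (hii a b) (hii b t),
    ← intervalIntegral.integral_add_adjacent_intervals (hii b (t - b)) (hii (t - b) t)]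
  linarith

/-- At a maximum point `τ` of `g` on `[0, t]` the equation gives `g τ ≤ 1 + g τ / 2`, as `q` has
mass at most `1`. -/
theorem renewal_le_two {h q g : ℝ → ℝ}
    (hq : ∀ t, HasDerivAt h (-q t) t) (qc : Continuous q) (q0 : ∀ t, 0 ≤ q t)
    (hpos : ∀ t, 0 < h t) (h0 : h 0 = 1) (gc : Continuous g) (g0 : ∀ t, 0 ≤ t → 0 ≤ g t)
    (hg : ∀ t, 0 ≤ t → g t = h t + 1 / 2 * ∫ s in (0 : ℝ)..t, q s * g (t - s))
    {t : ℝ} (ht : 0 ≤ t) : g t ≤ 2 := by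
  obtain ⟨τ, hτ, hmax⟩ := isCompact_Icc.exists_isMaxOn (Set.nonempty_Icc.2 ht) gc.continuousOn
  have hanti := antitone_of_neg_deriv_nonneg hq q0
  refine (hmax (Set.right_mem_Icc.2 ht)).trans ?_
  have h1 : ∫ s in (0 : ℝ)..τ, q s * g (τ - s) ≤ ∫ s in (0 : ℝ)..τ, q s * g τ := by
    refine intervalIntegral.integral_mono_on hτ.1
      ((by fun_prop : Continuous fun s => q s * g (τ - s)).intervalIntegrable _ _)
      ((qc.mul continuous_const).intervalIntegrable _ _) fun s hs => ?_
    exact mul_le_mul_of_nonneg_left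
      (hmax ⟨by linarith [hs.2], by linarith [hs.1, hτ.2]⟩) (q0 s)
  rw [intervalIntegral.integral_mul_const, integral_neg_deriv hq qc, h0] at h1
  have h2 := hg τ hτ.1
  have h3 : h τ ≤ 1 := h0 ▸ hanti hτ.1
  have h4 := hpos τ
  have h5 := g0 τ hτ.1
  show g τ ≤ 2
  nlinarith

/-- The renewal equation is read at a maximum point `τ` of `g / (exp (ε s) * h)`: the tilted
convolution bound gives `S ≤ 1 + 3/4 * S` there. -/
theorem renewal_upper_bound {h q g : ℝ → ℝ} {R M Λ K ε : ℝ}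
    (hq : ∀ t, HasDerivAt h (-q t) t) (qc : Continuous q) (q0 : ∀ t, 0 ≤ q t)
    (hpos : ∀ t, 0 < h t) (h0 : h 0 = 1) (hint : ∀ t, 0 ≤ t → ∫ s in (0 : ℝ)..t, h s ≤ 1)
    (qR : ∀ t, 0 < t → q t ≤ R / min t M * h t) (qL : ∀ t, q t ≤ Λ * h t)
    (hmul : ∀ s u, M ≤ s → M ≤ u → h s * h u ≤ K * h (s + u))
    (hR : 1 ≤ R) (hΛ : 0 ≤ Λ) (hε : 0 < ε) (hεK : 12 * (Λ * K) ≤ ε)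
    (hM : 60 * R * Real.exp R ≤ M) (gc : Continuous g) (g0 : ∀ t, 0 ≤ t → 0 ≤ g t)
    (hg : ∀ t, 0 ≤ t → g t = h t + 1 / 2 * ∫ s in (0 : ℝ)..t, q s * g (t - s))
    {t : ℝ} (ht : 0 ≤ t) :
    g t ≤ (2 * Real.exp (Λ * (120 * R * Real.exp R)) + 4) * Real.exp (ε * t) * h t := by
  have hc : Continuous h := continuous_iff_continuousAt.2 fun t => (hq t).continuousAt
  have hφc : Continuous fun s => g s / (Real.exp (ε * s) * h s) :=
    gc.div (by fun_prop) fun s => (mul_pos (Real.exp_pos _) (hpos s)).ne'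
  obtain ⟨τ, hτ, hmax⟩ := isCompact_Icc.exists_isMaxOn (Set.nonempty_Icc.2 ht) hφc.continuousOn
  set S := g τ / (Real.exp (ε * τ) * h τ) with hS
  have hS' : ∀ s, 0 ≤ s → s ≤ t → g s ≤ S * (Real.exp (ε * s) * h s) := fun s h1 h2 =>
    (div_le_iff₀ (mul_pos (Real.exp_pos _) (hpos s))).1 (hmax ⟨h1, h2⟩)
  have hτpos := mul_pos (Real.exp_pos (ε * τ)) (hpos τ)
  have hS0 : 0 ≤ S := div_nonneg (g0 τ hτ.1) hτpos.le
  have hgτ : g τ = S * (Real.exp (ε * τ) * h τ) := by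
    rw [hS, div_mul_cancel₀ _ hτpos.ne']
  have hexp : 1 ≤ Real.exp (ε * τ) := Real.one_le_exp (mul_nonneg hε.le hτ.1)
  have key : S ≤ 2 * Real.exp (Λ * (120 * R * Real.exp R)) + 4 := by
    -- The threshold is twice `60 * R * exp R`, as `tilted_convolution_le` asks of `τ / 2`. Below
    -- it, `g ≤ 2` and `h τ ≥ exp (-Λ τ)` suffice.
    rcases le_total τ (120 * R * Real.exp R) with hlt | hge
    · have h1 := renewal_le_two hq qc q0 hpos h0 gc g0 hg hτ.1
      have h2 := le_exp_mul_of_neg_deriv_le (ρ := Λ) hq hτ.1 fun x _ _ => qL x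
      rw [h0, sub_zero] at h2
      have h3 : Real.exp (Λ * τ) ≤ Real.exp (Λ * (120 * R * Real.exp R)) := by gcongr
      have h4 : S ≤ 2 * Real.exp (Λ * τ) := by
        rw [hS, div_le_iff₀ hτpos]
        have h5 := Real.exp_pos (Λ * τ)
        nlinarith [mul_pos h5 (hpos τ)]
      linarith
    · have h1 := tilted_convolution_le (t := τ) hq qc q0 hpos h0 hint qR qL hmul hR hΛ hε hεK
        (le_min (by linarith) hM)
      have h2 : ∫ s in (0 : ℝ)..τ, q s * g (τ - s) ≤
          ∫ s in (0 : ℝ)..τ, (S * Real.exp (ε * τ)) *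
            (q s * Real.exp (-(ε * s)) * h (τ - s)) := by
        refine intervalIntegral.integral_mono_on hτ.1
          ((by fun_prop : Continuous fun s => q s * g (τ - s)).intervalIntegrable _ _)
          ((by fun_prop : Continuous fun s => (S * Real.exp (ε * τ)) *
            (q s * Real.exp (-(ε * s)) * h (τ - s))).intervalIntegrable _ _) fun s hs => ?_
        have h3 := hS' (τ - s) (by linarith [hs.2]) (by linarith [hs.1, hτ.2])
        have h4 : Real.exp (ε * (τ - s)) = Real.exp (ε * τ) * Real.exp (-(ε * s)) := by
          rw [← Real.exp_add]; ring_nf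
        rw [h4] at h3
        calc q s * g (τ - s) ≤ _ := mul_le_mul_of_nonneg_left h3 (q0 s)
          _ = _ := by ring
      rw [intervalIntegral.integral_const_mul] at h2
      have h5 := mul_le_mul_of_nonneg_left h1 (mul_nonneg hS0 (Real.exp_pos (ε * τ)).le)
      have h6 := hg τ hτ.1
      have h7 : S * (Real.exp (ε * τ) * h τ) ≤ 4 * (Real.exp (ε * τ) * h τ) := by
        have := hpos τ
        nlinarith
      have h8 := le_of_mul_le_mul_right h7 hτpos
      have := Real.exp_pos (Λ * (120 * R * Real.exp R))
      linarith
  refine (hS' t ht le_rfl).trans ?_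
  rw [mul_assoc]
  exact mul_le_mul_of_nonneg_right key (mul_pos (Real.exp_pos _) (hpos t)).le

theorem renewal_lower_bound {h q g : ℝ → ℝ}
    (hq : ∀ t, HasDerivAt h (-q t) t) (qc : Continuous q) (q0 : ∀ t, 0 ≤ q t)
    (h0 : h 0 = 1) (gc : Continuous g) (g0 : ∀ t, 0 ≤ t → 0 ≤ g t)
    (hg : ∀ t, 0 ≤ t → g t = h t + 1 / 2 * ∫ s in (0 : ℝ)..t, q s * g (t - s))
    {t : ℝ} (ht : 0 ≤ t) : (1 + 1 / 2 * (1 - h t)) * h t ≤ g t := by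
  have hanti := antitone_of_neg_deriv_nonneg hq q0
  have hge : ∀ s, 0 ≤ s → h s ≤ g s := by
    intro s hs
    have h1 : 0 ≤ ∫ u in (0 : ℝ)..s, q u * g (s - u) :=
      intervalIntegral.integral_nonneg hs fun u hu => mul_nonneg (q0 u) (g0 _ (by linarith [hu.2]))
    linarith [hg s hs]
  have h1 : ∫ s in (0 : ℝ)..t, q s * h t ≤ ∫ s in (0 : ℝ)..t, q s * g (t - s) := by
    refine intervalIntegral.integral_mono_on ht
      ((qc.mul continuous_const).intervalIntegrable _ _)
      ((by fun_prop : Continuous fun s => q s * g (t - s)).intervalIntegrable _ _) fun s hs => ?_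
    exact mul_le_mul_of_nonneg_left
      ((hanti (by linarith [hs.1])).trans (hge (t - s) (by linarith [hs.2]))) (q0 s)
  rw [intervalIntegral.integral_mul_const, integral_neg_deriv hq qc, h0] at h1
  have h2 := hg t ht
  nlinarith

/-! ### Sums of decaying exponentials -/

section ExpSum

variable {ι : Type*} [Fintype ι]

/-- The finite sum of exponentials `∑ c_k exp (-λ_k t)`. -/
noncomputable def expSum (c l : ι → ℝ) (t : ℝ) : ℝ := ∑ k, c k * Real.exp (-(l k * t))

theorem hasDerivAt_expSum (c l : ι → ℝ) (t : ℝ) :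
    HasDerivAt (expSum c l) (-expSum (fun k => c k * l k) l t) t := by
  have h : ∀ k ∈ Finset.univ, HasDerivAt (fun t => c k * Real.exp (-(l k * t)))
      (-(c k * l k * Real.exp (-(l k * t)))) t := by
    intro k _
    have h1 : HasDerivAt (fun t => -(l k * t)) (-(l k * 1)) t :=
      ((hasDerivAt_id t).const_mul (l k)).neg
    exact (h1.exp.const_mul (c k)).congr_deriv (by ring)
  have h2 := HasDerivAt.fun_sum h
  rw [Finset.sum_neg_distrib] at h2
  exact h2

theorem continuous_expSum (c l : ι → ℝ) : Continuous (expSum c l) :=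
  continuous_iff_continuousAt.2 fun t => (hasDerivAt_expSum c l t).continuousAt

theorem expSum_nonneg {c : ι → ℝ} (hc : ∀ k, 0 ≤ c k) (l : ι → ℝ) (t : ℝ) : 0 ≤ expSum c l t :=
  Finset.sum_nonneg fun k _ => mul_nonneg (hc k) (Real.exp_pos _).le

/-- The logarithmic derivative of a sum of exponentials is monotone. -/
theorem expSum_logDeriv_mono {c l : ι → ℝ} (hc : ∀ k, 0 ≤ c k) {s t : ℝ} (hst : s ≤ t) :
    expSum (fun k => c k * l k) l t * expSum c l s ≤
      expSum (fun k => c k * l k) l s * expSum c l t := by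
  -- Symmetrizing the double sum in `k` and `m` produces `l k - l m` times a difference of
  -- exponentials of the same sign.
  have key : 0 ≤ 2 * (expSum (fun k => c k * l k) l s * expSum c l t -
      expSum (fun k => c k * l k) l t * expSum c l s) := by
    have e1 : ∀ s t : ℝ, expSum (fun k => c k * l k) l s * expSum c l t =
        ∑ k, ∑ m, c k * c m * (l k * (Real.exp (-(l k * s)) * Real.exp (-(l m * t)))) := by
      intro s t
      rw [expSum, expSum, Finset.sum_mul_sum]
      exact Finset.sum_congr rfl fun k _ => Finset.sum_congr rfl fun m _ => by ring
    have e2 : ∀ s t : ℝ, expSum (fun k => c k * l k) l s * expSum c l t =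
        ∑ k, ∑ m, c k * c m * (l m * (Real.exp (-(l m * s)) * Real.exp (-(l k * t)))) := by
      intro s t
      rw [e1, Finset.sum_comm]
      exact Finset.sum_congr rfl fun k _ => Finset.sum_congr rfl fun m _ => by ring
    rw [two_mul]
    nth_rewrite 1 [e1 s t, e1 t s]
    rw [e2 s t, e2 t s, ← Finset.sum_sub_distrib, ← Finset.sum_sub_distrib,
      ← Finset.sum_add_distrib]
    refine Finset.sum_nonneg fun k _ => ?_
    rw [← Finset.sum_sub_distrib, ← Finset.sum_sub_distrib, ← Finset.sum_add_distrib]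
    refine Finset.sum_nonneg fun m _ => ?_
    rw [← Real.exp_add, ← Real.exp_add, ← Real.exp_add, ← Real.exp_add]
    have h1 : 0 ≤ (l k - l m) *
        (Real.exp (-(l k * s) + -(l m * t)) - Real.exp (-(l k * t) + -(l m * s))) := by
      rcases le_total (l k) (l m) with h | h
      · refine mul_nonneg_of_nonpos_of_nonpos (by linarith) (sub_nonpos.2 (Real.exp_le_exp.2 ?_))
        nlinarith
      · refine mul_nonneg (by linarith) (sub_nonneg.2 (Real.exp_le_exp.2 ?_))
        nlinarith
    have h2 := mul_nonneg (mul_nonneg (hc k) (hc m)) h1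
    rw [add_comm (-(l m * s)), add_comm (-(l m * t))]
    linarith
  linarith

/-- Half of the time absorbs the factor `l k`, since `x * exp (-(x * t / 2)) ≤ 2 / t`. -/
theorem expSum_mul_le_half {c l : ι → ℝ} (hc : ∀ k, 0 ≤ c k) {t : ℝ} (ht : 0 < t) :
    expSum (fun k => c k * l k) l t ≤ 2 / t * expSum c l (t / 2) := by
  rw [expSum, expSum, Finset.mul_sum]
  refine Finset.sum_le_sum fun k _ => ?_
  have h1 : Real.exp (-(l k * t)) = Real.exp (-(l k * (t / 2))) * Real.exp (-(l k * (t / 2))) := by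
    rw [← Real.exp_add]; ring_nf
  have h2 : l k * Real.exp (-(l k * (t / 2))) ≤ 2 / t := by
    have h3 := Real.add_one_le_exp (l k * (t / 2))
    rw [Real.exp_neg, ← div_eq_mul_inv, div_le_div_iff₀ (Real.exp_pos _) ht]
    linarith
  have h4 := hc k
  have h5 := (Real.exp_pos (-(l k * (t / 2)))).le
  calc c k * l k * Real.exp (-(l k * t))
      = c k * Real.exp (-(l k * (t / 2))) * (l k * Real.exp (-(l k * (t / 2)))) := by
        rw [h1]; ring
    _ ≤ c k * Real.exp (-(l k * (t / 2))) * (2 / t) := by gcongr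
    _ = _ := by ring

theorem integral_expSum_le {a l : ι → ℝ} (ha : ∀ k, 0 ≤ a k) (t : ℝ) :
    ∫ s in (0 : ℝ)..t, expSum (fun k => a k * l k) l s ≤ ∑ k, a k := by
  rw [integral_neg_deriv (hasDerivAt_expSum a l) (continuous_expSum _ _)]
  have h1 : expSum a l 0 = ∑ k, a k := by simp [expSum]
  have h2 := expSum_nonneg ha l t
  linarith

/-- Termwise `1 - exp (-x) ≥ x / (1 + x)` with `x = l k * t ≤ L`. -/
theorem one_sub_expSum_ge {c l : ι → ℝ} {L t : ℝ} (hc : ∀ k, 0 ≤ c k) (hl : ∀ k, 0 ≤ l k)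
    (hL : ∀ k, l k ≤ L) (h0 : expSum c l 0 = 1) (ht : 0 ≤ t) (ht1 : t ≤ 1) :
    t / (1 + L) * ∑ k, c k * l k ≤ 1 - expSum c l t := by
  have h1 : expSum c l 0 = ∑ k, c k := by simp [expSum]
  rw [h1] at h0
  rw [← h0, expSum, ← Finset.sum_sub_distrib, Finset.mul_sum]
  refine Finset.sum_le_sum fun k _ => ?_
  have hlk := hl k
  have h2 := Real.add_one_le_exp (l k * t)
  have h3 : Real.exp (-(l k * t)) ≤ 1 / (l k * t + 1) := by
    rw [Real.exp_neg, ← one_div]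
    exact one_div_le_one_div_of_le (by positivity) h2
  have h4 : t / (1 + L) * l k ≤ 1 - 1 / (l k * t + 1) := by
    have h5 : 1 - 1 / (l k * t + 1) = l k * t / (l k * t + 1) := by
      field_simp
      ring
    rw [h5, div_mul_eq_mul_div, mul_comm t]
    have h6 := hL k
    have h7 : l k * t ≤ L := by nlinarith
    rw [div_le_div_iff₀ (by linarith) (by positivity)]
    nlinarith [mul_nonneg hlk ht]
  rw [h0]
  calc _ = c k * (t / (1 + L) * l k) := by ring
    _ ≤ c k * (1 - Real.exp (-(l k * t))) := mul_le_mul_of_nonneg_left (by linarith) (hc k)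
    _ = _ := by ring

/-- Submultiplicativity, up to a constant, of a sum of exponentials past time `M`. -/
theorem expSum_mul_expSum_le {c l : ι → ℝ} {k₀ : ι} {M s u : ℝ} (hc : ∀ k, 0 ≤ c k)
    (hmin : ∀ k, c k ≠ 0 → l k₀ ≤ l k) (hk : 0 < c k₀) (hs : M ≤ s) (hu : M ≤ u) :
    expSum c l s * expSum c l u ≤
      Real.exp (2 * (l k₀ * M)) * expSum c l M ^ 2 / c k₀ * expSum c l (s + u) := by
  -- Past `M` every active term decays at rate at least `l k₀`; the `k₀` term alone bounds the sum
  -- at `s + u` from below.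
  have h1 : ∀ s, M ≤ s → expSum c l s ≤ Real.exp (-(l k₀ * (s - M))) * expSum c l M := by
    intro s hs
    rw [expSum, expSum, Finset.mul_sum]
    refine Finset.sum_le_sum fun k _ => ?_
    by_cases hck : c k = 0
    · simp [hck]
    · have h2 := hmin k hck
      have h3 : Real.exp (-(l k * s)) ≤ Real.exp (-(l k₀ * (s - M))) * Real.exp (-(l k * M)) := by
        rw [← Real.exp_add, Real.exp_le_exp]
        nlinarith
      calc _ ≤ c k * (Real.exp (-(l k₀ * (s - M))) * Real.exp (-(l k * M))) :=
            mul_le_mul_of_nonneg_left h3 (hc k)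
        _ = _ := by ring
  have h4 : c k₀ * Real.exp (-(l k₀ * (s + u))) ≤ expSum c l (s + u) :=
    Finset.single_le_sum (f := fun k => c k * Real.exp (-(l k * (s + u))))
      (fun k _ => mul_nonneg (hc k) (Real.exp_pos _).le) (Finset.mem_univ k₀)
  have h5 := expSum_nonneg hc l M
  calc expSum c l s * expSum c l u
      ≤ (Real.exp (-(l k₀ * (s - M))) * expSum c l M) *
          (Real.exp (-(l k₀ * (u - M))) * expSum c l M) :=
        mul_le_mul (h1 s hs) (h1 u hu) (expSum_nonneg hc l u)
          (mul_nonneg (Real.exp_pos _).le h5)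
    _ = (Real.exp (-(l k₀ * (s - M))) * Real.exp (-(l k₀ * (u - M)))) * expSum c l M ^ 2 := by ring
    _ = (Real.exp (2 * (l k₀ * M)) * Real.exp (-(l k₀ * (s + u)))) * expSum c l M ^ 2 := by
        rw [← Real.exp_add, ← Real.exp_add]; ring_nf
    _ = Real.exp (2 * (l k₀ * M)) * expSum c l M ^ 2 / c k₀ *
          (c k₀ * Real.exp (-(l k₀ * (s + u)))) := by field_simp
    _ ≤ _ := by gcongr

end ExpSum

/-! ### The spectrum of the Laplacian on the torus -/

section Spectrum

variable {d N : ℕ} [NeZero N]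

/-- The real part of the standard character of `ℤ / N`. -/
noncomputable def cosChar (j : ZMod N) : ℝ := (ZMod.stdAddChar j).re

/-- The eigenvalues of the discrete Laplacian on the cycle. -/
noncomputable def cycleEig (j : ZMod N) : ℝ := 2 - 2 * cosChar j

/-- The eigenvalues of the discrete Laplacian on the torus. -/
noncomputable def torusEig (k : Torus d N) : ℝ := ∑ i, cycleEig (k i)

theorem cosChar_zero : cosChar (0 : ZMod N) = 1 := by simp [cosChar]

theorem cosChar_add_add_cosChar_sub (a b : ZMod N) :
    cosChar (a + b) + cosChar (a - b) = 2 * cosChar b * cosChar a := by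
  have h : ((ZMod.toCircle (-b) : Circle) : ℂ) = (starRingEnd ℂ) (ZMod.toCircle b : Circle) := by
    rw [AddChar.map_neg_eq_inv, Circle.coe_inv_eq_conj]
  simp only [cosChar, ZMod.stdAddChar_apply, sub_eq_add_neg, AddChar.map_add_eq_mul, h, Complex.mul_re, Complex.conj_re, Complex.conj_im]
  ring

theorem abs_cosChar_le (j : ZMod N) : |cosChar j| ≤ 1 := by
  rw [cosChar, ZMod.stdAddChar_apply]
  exact (Complex.abs_re_le_norm _).trans (Circle.norm_coe _).le

theorem cycleEig_nonneg (j : ZMod N) : 0 ≤ cycleEig j := by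
  have := (abs_le.1 (abs_cosChar_le j)).2
  rw [cycleEig]; linarith

theorem cycleEig_le (j : ZMod N) : cycleEig j ≤ 4 := by
  have := (abs_le.1 (abs_cosChar_le j)).1
  rw [cycleEig]; linarith

theorem cycleEig_zero : cycleEig (0 : ZMod N) = 0 := by simp [cycleEig, cosChar_zero]

theorem torusEig_nonneg (k : Torus d N) : 0 ≤ torusEig k :=
  Finset.sum_nonneg fun _ _ => cycleEig_nonneg _

theorem torusEig_le (k : Torus d N) : torusEig k ≤ 4 * d := by
  refine (Finset.sum_le_sum fun _ _ => cycleEig_le _).trans ?_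
  simp [mul_comm]

theorem torusEig_zero : torusEig (0 : Torus d N) = 0 := by simp [torusEig, cycleEig_zero]

theorem cosChar_intCast (v : ℤ) :
    cosChar (v : ZMod N) = Real.cos (2 * Real.pi * v / N) := by
  rw [cosChar, ZMod.stdAddChar_coe]
  have : (2 * Real.pi * Complex.I * v / N : ℂ) =
      ((2 * Real.pi * v / N : ℝ) : ℂ) * Complex.I := by
    push_cast; ring
  rw [this, Complex.exp_ofReal_mul_I_re]

theorem natCast_pos_of_neZero : (0 : ℝ) < N := Nat.cast_pos.2 (NeZero.pos N)

/-- The constant `40` rounds up `4π²`; the matching `16` below comes from `cos x ≤ 1 - 2x²/π²` on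
`[-π, π]`. -/
theorem cycleEig_intCast_le (v : ℤ) : cycleEig (v : ZMod N) ≤ 40 * (v : ℝ) ^ 2 / (N : ℝ) ^ 2 := by
  have hN := natCast_pos_of_neZero (N := N)
  rw [cycleEig, cosChar_intCast]
  have h1 := Real.one_sub_sq_div_two_le_cos (x := 2 * Real.pi * v / N)
  have h2 : (2 * Real.pi * v / N) ^ 2 ≤ 40 * (v : ℝ) ^ 2 / (N : ℝ) ^ 2 := by
    rw [div_pow]
    gcongr
    have h3 : Real.pi ^ 2 ≤ 10 := by
      have := Real.pi_lt_d2
      have := Real.pi_pos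
      nlinarith
    rw [mul_pow, mul_pow]
    nlinarith [sq_nonneg (v : ℝ)]
  linarith

theorem le_cycleEig_intCast {v : ℤ} (hv : |v| * 2 ≤ N) :
    16 * (v : ℝ) ^ 2 / (N : ℝ) ^ 2 ≤ cycleEig (v : ZMod N) := by
  have hN := natCast_pos_of_neZero (N := N)
  have hv' : |(v : ℝ)| * 2 ≤ N := by exact_mod_cast hv
  rw [cycleEig, cosChar_intCast]
  have h1 : |2 * Real.pi * v / N| ≤ Real.pi := by
    rw [abs_div, abs_mul, abs_mul, abs_of_pos Real.pi_pos, abs_of_pos hN, div_le_iff₀ hN]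
    have := Real.pi_pos
    norm_num
    nlinarith
  have h2 := Real.cos_le_one_sub_mul_cos_sq h1
  have h3 : 2 / Real.pi ^ 2 * (2 * Real.pi * v / N) ^ 2 = 8 * (v : ℝ) ^ 2 / (N : ℝ) ^ 2 := by
    have := Real.pi_pos.ne'
    field_simp
    ring
  rw [h3] at h2
  have h4 : 16 * (v : ℝ) ^ 2 / (N : ℝ) ^ 2 = 2 * (8 * (v : ℝ) ^ 2 / (N : ℝ) ^ 2) := by ring
  rw [h4]
  linarith

theorem abs_valMinAbs_mul_two_le (j : ZMod N) : |j.valMinAbs| * 2 ≤ N := by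
  have := ZMod.valMinAbs_mem_Ioc j
  rw [Set.mem_Ioc] at this
  rcases abs_cases j.valMinAbs with h | h <;> omega

theorem le_cycleEig (j : ZMod N) :
    16 * (j.valMinAbs : ℝ) ^ 2 / (N : ℝ) ^ 2 ≤ cycleEig j := by
  have := le_cycleEig_intCast (abs_valMinAbs_mul_two_le j)
  rwa [ZMod.coe_valMinAbs] at this

theorem le_torusEig {k : Torus d N} (hk : k ≠ 0) : 16 / (N : ℝ) ^ 2 ≤ torusEig k := by
  obtain ⟨i, hi⟩ := Function.ne_iff.1 hk
  have h1 : cycleEig (k i) ≤ torusEig k :=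
    Finset.single_le_sum (f := fun i => cycleEig (k i)) (fun i _ => cycleEig_nonneg _)
      (Finset.mem_univ i)
  refine le_trans ?_ ((le_cycleEig (k i)).trans h1)
  have h2 : (k i).valMinAbs ≠ 0 := by
    rw [Ne, ZMod.valMinAbs_eq_zero]; exact hi
  have h3 : (1 : ℝ) ≤ ((k i).valMinAbs : ℝ) ^ 2 := by
    rw [← sq_abs]
    have : (1 : ℝ) ≤ |((k i).valMinAbs : ℝ)| := by exact_mod_cast Int.one_le_abs h2
    nlinarith
  gcongr
  linarith

/-- Division by three, rounded towards zero when `|v| ≥ 3` but away from zero when `|v| = 1, 2`, so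
that `w ≠ 0` whenever `v ≠ 0`. The offset `r - 2` ranges over `-2, ..., 2`. -/
theorem exists_int_third (v : ℤ) : ∃ w : ℤ, ∃ r : Fin 5, v = 3 * w + ((r : ℕ) : ℤ) - 2 ∧
    |v| ≤ 5 * |w| ∧ |w| ≤ |v| ∧ (3 * |w| ≤ |v| ∨ |w| ≤ 1) := by
  rcases lt_or_ge (|v|) 3 with h | h
  · rw [abs_lt] at h
    obtain ⟨h1, h2⟩ := h
    have h3 : v = -2 ∨ v = -1 ∨ v = 0 ∨ v = 1 ∨ v = 2 := by omega
    rcases h3 with rfl | rfl | rfl | rfl | rfl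
    · exact ⟨-1, 3, by norm_num⟩
    · exact ⟨-1, 4, by norm_num⟩
    · exact ⟨0, 2, by norm_num⟩
    · exact ⟨1, 0, by norm_num⟩
    · exact ⟨1, 1, by norm_num⟩
  · rcases le_total 0 v with hv | hv
    · rw [abs_of_nonneg hv] at h ⊢
      refine ⟨v / 3, ⟨(v % 3).toNat + 2, by omega⟩, by push_cast; omega, ?_⟩
      rw [abs_of_nonneg (by omega)]
      omega
    · rw [abs_of_nonpos hv] at h ⊢
      refine ⟨-((-v) / 3), ⟨2 - ((-v) % 3).toNat, by omega⟩, by push_cast; omega, ?_⟩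
      rw [abs_neg, abs_of_nonneg (by omega)]
      omega

/-- A third of the frequency has less than half the eigenvalue (`16 * 9 ≥ 2 * 40`), which offsets
the halved time. If `|w| ≤ 1` instead, the exponent at `w` is at most `40` up to time `N ^ 2`. The
factor `63` is `40 * 25 / 16` rounded up. -/
theorem exists_third (j : ZMod N) : ∃ w : ZMod N, ∃ r : Fin 5, j = 3 * w + ((r : ℕ) : ZMod N) - 2 ∧
    cycleEig j ≤ 63 * cycleEig w ∧ ∀ t : ℝ, 0 ≤ t → t ≤ (N : ℝ) ^ 2 →
      Real.exp (-(cycleEig j * (t / 2))) ≤ Real.exp 40 * Real.exp (-(cycleEig w * t)) := by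
  have hN := natCast_pos_of_neZero (N := N)
  obtain ⟨w, r, h1, h2, h3, h4⟩ := exists_int_third j.valMinAbs
  set v := j.valMinAbs with hv
  have hj : (v : ZMod N) = j := ZMod.coe_valMinAbs j
  have hv2 := abs_valMinAbs_mul_two_le j
  rw [← hv] at hv2
  have hw := le_cycleEig_intCast (N := N) (v := w) (by linarith)
  have hw' := cycleEig_intCast_le (N := N) w
  have hjl := le_cycleEig j
  have hju := cycleEig_intCast_le (N := N) v
  rw [hj] at hju
  rw [← hv] at hjl
  refine ⟨w, r, ?_, ?_, fun t ht0 ht => ?_⟩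
  · rw [← hj, h1]; push_cast; ring
  · have h5 : (v : ℝ) ^ 2 ≤ 25 * (w : ℝ) ^ 2 := by
      have : |(v : ℝ)| ≤ 5 * |(w : ℝ)| := by exact_mod_cast h2
      rw [← sq_abs (v : ℝ), ← sq_abs (w : ℝ)]
      nlinarith [abs_nonneg (v : ℝ)]
    refine hju.trans ?_
    calc 40 * (v : ℝ) ^ 2 / (N : ℝ) ^ 2 ≤ 63 * (16 * (w : ℝ) ^ 2) / (N : ℝ) ^ 2 := by
          gcongr ?_ / _; nlinarith [sq_nonneg (w : ℝ)]
      _ = 63 * (16 * (w : ℝ) ^ 2 / (N : ℝ) ^ 2) := by ring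
      _ ≤ _ := by gcongr
  · rw [← Real.exp_add, Real.exp_le_exp]
    rcases h4 with h4 | h4
    · have h5 : 9 * (w : ℝ) ^ 2 ≤ (v : ℝ) ^ 2 := by
        have : 3 * |(w : ℝ)| ≤ |(v : ℝ)| := by exact_mod_cast h4
        rw [← sq_abs (v : ℝ), ← sq_abs (w : ℝ)]
        nlinarith [abs_nonneg (w : ℝ)]
      have h6 : 2 * cycleEig (w : ZMod N) ≤ cycleEig j := by
        refine le_trans ?_ hjl
        calc 2 * cycleEig (w : ZMod N) ≤ 2 * (40 * (w : ℝ) ^ 2 / (N : ℝ) ^ 2) := by gcongr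
          _ = 80 * (w : ℝ) ^ 2 / (N : ℝ) ^ 2 := by ring
          _ ≤ _ := by gcongr ?_ / _; nlinarith [sq_nonneg (w : ℝ)]
      nlinarith
    · have h5 : (w : ℝ) ^ 2 ≤ 1 := by
        have : |(w : ℝ)| ≤ 1 := by exact_mod_cast h4
        rw [← sq_abs]
        nlinarith [abs_nonneg (w : ℝ)]
      have h6 : cycleEig (w : ZMod N) * t ≤ 40 := by
        calc cycleEig (w : ZMod N) * t ≤ (40 * (w : ℝ) ^ 2 / (N : ℝ) ^ 2) * (N : ℝ) ^ 2 := by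
              gcongr
          _ = 40 * (w : ℝ) ^ 2 := by field_simp
          _ ≤ 40 := by linarith
      have h7 := mul_nonneg (cycleEig_nonneg j) (by linarith : 0 ≤ t / 2)
      linarith

/-- The eigenvalue sum `∑_k λ_k exp (-λ_k t)` is doubling up to time `N ^ 2`. -/
theorem sum_torusEig_exp_doubling {t : ℝ} (ht0 : 0 ≤ t) (ht : t ≤ (N : ℝ) ^ 2) :
    ∑ k : Torus d N, torusEig k * Real.exp (-(torusEig k * (t / 2))) ≤
      63 * Real.exp 40 ^ d * 5 ^ d *
        ∑ k : Torus d N, torusEig k * Real.exp (-(torusEig k * t)) := by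
  choose w r h1 h2 h3 using exists_third (N := N)
  -- Quotient and remainder recover `k`, so each quotient is hit at most `5 ^ d` times.
  let F : Torus d N → Torus d N × (Fin d → Fin 5) := fun k => (fun i => w (k i), fun i => r (k i))
  have hF : Function.Injective F := by
    intro k k' hkk
    rw [Prod.mk.injEq] at hkk
    funext i
    rw [h1 (k i), h1 (k' i), congrFun hkk.1 i, congrFun hkk.2 i]
  have hle : ∀ k : Torus d N, torusEig k * Real.exp (-(torusEig k * (t / 2))) ≤
      63 * Real.exp 40 ^ d *
        (torusEig (F k).1 * Real.exp (-(torusEig (F k).1 * t))) := by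
    intro k
    have e1 : torusEig k ≤ 63 * torusEig (F k).1 := by
      rw [torusEig, torusEig, Finset.mul_sum]
      exact Finset.sum_le_sum fun i _ => h2 (k i)
    have e2 : Real.exp (-(torusEig k * (t / 2))) ≤
        Real.exp 40 ^ d * Real.exp (-(torusEig (F k).1 * t)) := by
      rw [torusEig, torusEig, Finset.sum_mul, Finset.sum_mul, ← Finset.sum_neg_distrib,
        ← Finset.sum_neg_distrib, Real.exp_sum, Real.exp_sum]
      refine (Finset.prod_le_prod (fun i _ => (Real.exp_pos _).le)
        fun i _ => h3 (k i) t ht0 ht).trans ?_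
      rw [Finset.prod_mul_distrib]
      simp [F]
    calc _ ≤ (63 * torusEig (F k).1) *
          (Real.exp 40 ^ d * Real.exp (-(torusEig (F k).1 * t))) :=
          mul_le_mul e1 e2 (Real.exp_pos _).le (mul_nonneg (by norm_num) (torusEig_nonneg _))
      _ = _ := by ring
  refine (Finset.sum_le_sum fun k _ => hle k).trans ?_
  rw [← Finset.mul_sum, mul_assoc (63 * Real.exp 40 ^ d)]
  refine mul_le_mul_of_nonneg_left ?_ (by positivity)
  have h4 := Finset.sum_le_sum_of_subset_of_nonneg
    (f := fun p : Torus d N × (Fin d → Fin 5) => torusEig p.1 * Real.exp (-(torusEig p.1 * t)))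
    (Finset.subset_univ (Finset.univ.map ⟨F, hF⟩))
    (fun p _ _ => mul_nonneg (torusEig_nonneg _) (Real.exp_pos _).le)
  rw [Finset.sum_map, Fintype.sum_prod_type] at h4
  refine h4.trans (le_of_eq ?_)
  simp [← Finset.mul_sum]

theorem exists_sum_exp_cycleEig_le : ∃ C : ℝ, 0 < C ∧ ∀ (N : ℕ) [NeZero N],
    ∑ j : ZMod N, Real.exp (-(cycleEig j * ((N : ℝ) ^ 2 / 2))) ≤ C := by
  -- The indicator covers `v = 0`, where `1 / 0 = 0`. Elsewhere the exponent is at least `8 * v ^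
  -- 2`, uniformly in `N`.
  let f : ℤ → ℝ := fun v => 1 / (v : ℝ) ^ 2 + (if v = 0 then 1 else 0)
  have hf : Summable f :=
    (Real.summable_one_div_int_pow.2 (by norm_num)).add (hasSum_ite_eq 0 1).summable
  have hf0 : ∀ v, 0 ≤ f v := fun v => by
    have : (0 : ℝ) ≤ if v = 0 then 1 else 0 := by split_ifs <;> norm_num
    have : (0 : ℝ) ≤ 1 / (v : ℝ) ^ 2 := by positivity
    simp only [f]; linarith
  refine ⟨1 + ∑' v, f v, by have : 0 ≤ ∑' v, f v := tsum_nonneg hf0; linarith, fun N _ => ?_⟩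
  have hN := natCast_pos_of_neZero (N := N)
  have h1 : ∀ j : ZMod N, Real.exp (-(cycleEig j * ((N : ℝ) ^ 2 / 2))) ≤ f j.valMinAbs := by
    intro j
    have h2 := le_cycleEig j
    by_cases hv : j.valMinAbs = 0
    · simp only [f, hv]
      have := mul_nonneg (cycleEig_nonneg j) (by positivity : 0 ≤ (N : ℝ) ^ 2 / 2)
      simp only [if_true, Int.cast_zero]
      norm_num
      linarith
    · have h3 : 8 * (j.valMinAbs : ℝ) ^ 2 ≤ cycleEig j * ((N : ℝ) ^ 2 / 2) := by
        rw [div_le_iff₀ (by positivity)] at h2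
        linarith
      simp only [f, if_neg hv, add_zero]
      have h4 : (0 : ℝ) < (j.valMinAbs : ℝ) ^ 2 := by positivity
      have h5 := Real.add_one_le_exp (cycleEig j * ((N : ℝ) ^ 2 / 2))
      rw [Real.exp_neg, ← one_div]
      exact one_div_le_one_div_of_le h4 (by linarith)
  refine (Finset.sum_le_sum fun j _ => h1 j).trans ?_
  have h6 := hf.sum_le_tsum
    (Finset.univ.map ⟨fun j : ZMod N => j.valMinAbs, ZMod.injective_valMinAbs⟩) fun v _ => hf0 v
  rw [Finset.sum_map] at h6
  exact h6.trans (by linarith)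

theorem sum_exp_torusEig (t : ℝ) : ∑ k : Torus d N, Real.exp (-(torusEig k * t)) =
    (∑ j : ZMod N, Real.exp (-(cycleEig j * t))) ^ d := by
  have := Fintype.sum_pow (fun j : ZMod N => Real.exp (-(cycleEig j * t))) d
  rw [this]
  refine Finset.sum_congr rfl fun k _ => ?_
  rw [torusEig, Finset.sum_mul, ← Finset.sum_neg_distrib, Real.exp_sum]

end Spectrum

/-! ### Heat kernel of the torus -/

section HeatKernel

variable {d N : ℕ} [NeZero N]

/-- The discrete Laplacian on the torus. -/
def torusLap (F : Torus d N → ℝ) (z : Torus d N) : ℝ :=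
  ∑ i, (F (z + Pi.single i 1) + F (z - Pi.single i 1) - 2 * F z)

theorem sum_torusLap_mul (F H : Torus d N → ℝ) :
    ∑ z, torusLap F z * H z = ∑ z, F z * torusLap H z := by
  simp only [torusLap, Finset.sum_mul, Finset.mul_sum]
  rw [Finset.sum_comm, Finset.sum_comm (s := Finset.univ (α := Torus d N))]
  refine Finset.sum_congr rfl fun i _ => ?_
  have h1 := Equiv.sum_comp (Equiv.addRight (Pi.single i 1 : Torus d N))
    fun z => F z * H (z - Pi.single i 1)
  have h2 := Equiv.sum_comp (Equiv.subRight (Pi.single i 1 : Torus d N))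
    fun z => F z * H (z + Pi.single i 1)
  simp only [Equiv.coe_addRight, add_sub_cancel_right] at h1
  simp only [Equiv.subRight_apply, sub_add_cancel] at h2
  simp only [add_mul, sub_mul, mul_add, mul_sub, Finset.sum_add_distrib, Finset.sum_sub_distrib]
  have h3 : ∑ z, 2 * F z * H z = ∑ z, F z * (2 * H z) :=
    Finset.sum_congr rfl fun z _ => by ring
  rw [h1, h2, h3]
  ring

theorem sum_cosChar_dotProduct (z : Torus d N) :
    ∑ k : Torus d N, cosChar (k ⬝ᵥ z) = if z = 0 then (N : ℝ) ^ d else 0 := by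
  have h1 : ∑ k : Torus d N, (ZMod.stdAddChar (k ⬝ᵥ z) : ℂ) =
      if z = 0 then ((N : ℂ)) ^ d else 0 := by
    have h2 : ∀ k : Torus d N, (ZMod.stdAddChar (k ⬝ᵥ z) : ℂ) =
        ∏ i, ZMod.stdAddChar (k i * z i) := fun k => by
      exact map_prod (ZMod.stdAddChar (N := N)).toMonoidHom
        (fun i => Multiplicative.ofAdd (k i * z i)) Finset.univ
    have h3 := Finset.prod_univ_sum (fun _ : Fin d => (Finset.univ : Finset (ZMod N)))
      (fun i j => (ZMod.stdAddChar (j * z i) : ℂ))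
    rw [Fintype.piFinset_univ] at h3
    simp only [h2]
    rw [← h3]
    simp only [AddChar.sum_mulShift _ (ZMod.isPrimitive_stdAddChar N), ZMod.card]
    split_ifs with h
    · subst h; simp
    · obtain ⟨i, hi⟩ := Function.ne_iff.1 h
      exact Finset.prod_eq_zero (Finset.mem_univ i) (by simp [show z i ≠ 0 from hi])
  have h4 := congrArg Complex.re h1
  rw [Complex.re_sum] at h4
  simp only [cosChar, h4]
  split_ifs
  · rw [← Complex.ofReal_natCast, ← Complex.ofReal_pow, Complex.ofReal_re]
  · simp

theorem cosChar_dotProduct_second_diff (k z : Torus d N) (i : Fin d) :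
    cosChar (k ⬝ᵥ (z + Pi.single i 1)) + cosChar (k ⬝ᵥ (z - Pi.single i 1)) -
      2 * cosChar (k ⬝ᵥ z) = -(cycleEig (k i) * cosChar (k ⬝ᵥ z)) := by
  rw [dotProduct_add, dotProduct_sub, dotProduct_single, mul_one, cosChar_add_add_cosChar_sub,
    cycleEig]
  ring

/-- Minus the time derivative of the heat kernel on the torus. -/
noncomputable def heatFlux (d N : ℕ) [NeZero N] (u : ℝ) (z : Torus d N) : ℝ :=
  expSum (fun k : Torus d N => torusEig k * cosChar (k ⬝ᵥ z) / (N : ℝ) ^ d) torusEig u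

/-- The rate of decay of the return probability, normalized at time zero. -/
noncomputable def decayProfile (d N : ℕ) [NeZero N] : ℝ → ℝ :=
  expSum (fun k : Torus d N => torusEig k / (2 * d * (N : ℝ) ^ d)) torusEig

/-- Minus the derivative of the decay profile. -/
noncomputable def decayRate (d N : ℕ) [NeZero N] : ℝ → ℝ :=
  expSum (fun k : Torus d N => torusEig k / (2 * d * (N : ℝ) ^ d) * torusEig k) torusEig

theorem hasDerivAt_decayProfile (t : ℝ) :
    HasDerivAt (decayProfile d N) (-decayRate d N t) t := hasDerivAt_expSum _ _ _

theorem continuous_decayRate : Continuous (decayRate d N) := continuous_expSum _ _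

theorem heatFlux_eq_sum (u : ℝ) (z : Torus d N) : heatFlux d N u z =
    1 / (N : ℝ) ^ d * ∑ k : Torus d N,
      torusEig k * Real.exp (-(torusEig k * u)) * cosChar (k ⬝ᵥ z) := by
  rw [heatFlux, expSum, Finset.mul_sum]
  exact Finset.sum_congr rfl fun k _ => by ring

theorem heatFlux_second_diff (u : ℝ) (z : Torus d N) (i : Fin d) :
    heatFlux d N u (z + Pi.single i 1) + heatFlux d N u (z - Pi.single i 1) -
      2 * heatFlux d N u z = -(1 / (N : ℝ) ^ d * ∑ k : Torus d N,
        torusEig k * Real.exp (-(torusEig k * u)) * (cycleEig (k i) * cosChar (k ⬝ᵥ z))) := by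
  simp only [heatFlux_eq_sum]
  have h : ∀ a b c x : ℝ, x * a + x * b - 2 * (x * c) = x * (a + b - 2 * c) := by intros; ring
  rw [h, ← mul_neg, ← Finset.sum_neg_distrib, Finset.mul_sum (a := (2 : ℝ)),
    ← Finset.sum_add_distrib, ← Finset.sum_sub_distrib]
  congr 1
  refine Finset.sum_congr rfl fun k _ => ?_
  rw [neg_mul_eq_mul_neg (torusEig k * _) (cycleEig (k i) * _), ← cosChar_dotProduct_second_diff]
  ring

theorem torusLap_heatFlux (u : ℝ) (z : Torus d N) : torusLap (heatFlux d N u) z =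
    -expSum (fun k : Torus d N => torusEig k * cosChar (k ⬝ᵥ z) / (N : ℝ) ^ d * torusEig k)
      torusEig u := by
  rw [torusLap]
  simp only [heatFlux_second_diff]
  rw [Finset.sum_neg_distrib, ← Finset.mul_sum, Finset.sum_comm, expSum, Finset.mul_sum]
  congr 1
  refine Finset.sum_congr rfl fun k _ => ?_
  rw [← Finset.mul_sum, ← Finset.sum_mul, ← torusEig]
  ring

theorem hasDerivAt_heatFlux (u : ℝ) (z : Torus d N) :
    HasDerivAt (fun u => heatFlux d N u z) (torusLap (heatFlux d N u) z) u := by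
  rw [torusLap_heatFlux]
  exact hasDerivAt_expSum _ _ _

theorem heatFlux_at_zero (hd : 1 ≤ d) (u : ℝ) :
    heatFlux d N u 0 = 2 * d * decayProfile d N u := by
  have hd' : (d : ℝ) ≠ 0 := by positivity
  have hN := (natCast_pos_of_neZero (N := N)).ne'
  rw [heatFlux, decayProfile, expSum, expSum, Finset.mul_sum]
  refine Finset.sum_congr rfl fun k _ => ?_
  rw [dotProduct_zero, cosChar_zero]
  field_simp

/-- Fourier inversion: the point mass at the origin is the average of the characters. -/
theorem heatFlux_zero_time (z : Torus d N) :
    heatFlux d N 0 z = -torusLap (fun z => if z = 0 then (1 : ℝ) else 0) z := by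
  have hN := (natCast_pos_of_neZero (N := N)).ne'
  have h1 : (fun z : Torus d N => if z = 0 then (1 : ℝ) else 0) =
      fun z => 1 / (N : ℝ) ^ d * ∑ k : Torus d N, cosChar (k ⬝ᵥ z) := by
    funext z
    rw [sum_cosChar_dotProduct]
    split_ifs
    · field_simp
    · simp
  rw [h1, torusLap, heatFlux_eq_sum]
  have h2 : ∀ i : Fin d, 1 / (N : ℝ) ^ d * ∑ k : Torus d N, cosChar (k ⬝ᵥ (z + Pi.single i 1)) +
      1 / (N : ℝ) ^ d * ∑ k : Torus d N, cosChar (k ⬝ᵥ (z - Pi.single i 1)) -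
      2 * (1 / (N : ℝ) ^ d * ∑ k : Torus d N, cosChar (k ⬝ᵥ z)) =
      -(1 / (N : ℝ) ^ d * ∑ k : Torus d N, cycleEig (k i) * cosChar (k ⬝ᵥ z)) := by
    intro i
    rw [← mul_neg, ← Finset.sum_neg_distrib]
    simp only [← cosChar_dotProduct_second_diff, Finset.sum_add_distrib, Finset.sum_sub_distrib,
      ← Finset.mul_sum]
    ring
  simp only [h2]
  rw [Finset.sum_neg_distrib, neg_neg, ← Finset.mul_sum, Finset.sum_comm]
  congr 1
  refine Finset.sum_congr rfl fun k _ => ?_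
  rw [← Finset.sum_mul, ← torusEig]
  simp

theorem torusEig_comp_perm (k : Torus d N) (σ : Equiv.Perm (Fin d)) :
    torusEig (k ∘ σ : Torus d N) = torusEig k :=
  Equiv.sum_comp σ fun i => cycleEig (k i)

/-- By symmetry under permutations of coordinates each direction carries `1 / d` of the Laplacian at
the origin. Being independent of `i`, it lets the sources enter only through their sum. -/
theorem heatFlux_second_diff_zero (hd : 1 ≤ d) (u : ℝ) (i : Fin d) :
    2 * heatFlux d N u 0 - heatFlux d N u (Pi.single i 1) - heatFlux d N u (-Pi.single i 1) =
      2 * decayRate d N u := by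
  have hd' : (d : ℝ) ≠ 0 := by positivity
  have hN := (natCast_pos_of_neZero (N := N)).ne'
  have h1 := heatFlux_second_diff (d := d) (N := N) u 0 i
  have h2 : ∀ j : Fin d,
      ∑ k : Torus d N, torusEig k * Real.exp (-(torusEig k * u)) * cycleEig (k j) =
      ∑ k : Torus d N, torusEig k * Real.exp (-(torusEig k * u)) * cycleEig (k i) := by
    intro j
    rw [← Equiv.sum_comp (Equiv.arrowCongr (Equiv.swap i j) (Equiv.refl (ZMod N)))]
    refine Finset.sum_congr rfl fun k _ => ?_
    have h3 : (Equiv.arrowCongr (Equiv.swap i j) (Equiv.refl (ZMod N))) k =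
        (k ∘ Equiv.swap i j : Torus d N) := by
      funext x; simp [Equiv.arrowCongr]
    rw [h3, torusEig_comp_perm]
    simp
  have h4 : ∑ j : Fin d, ∑ k : Torus d N,
      torusEig k * Real.exp (-(torusEig k * u)) * cycleEig (k j) =
      d * ∑ k : Torus d N, torusEig k * Real.exp (-(torusEig k * u)) * cycleEig (k i) := by
    rw [Finset.sum_congr rfl fun j _ => h2 j]
    simp
  rw [Finset.sum_comm] at h4
  simp only [← Finset.mul_sum] at h4
  change ∑ k : Torus d N, torusEig k * Real.exp (-(torusEig k * u)) * torusEig k = _ at h4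
  simp only [zero_add, zero_sub, dotProduct_zero, cosChar_zero, mul_one] at h1
  have h5 : decayRate d N u = 1 / (2 * d * (N : ℝ) ^ d) * ∑ k : Torus d N,
      torusEig k * Real.exp (-(torusEig k * u)) * torusEig k := by
    rw [decayRate, expSum, Finset.mul_sum]
    exact Finset.sum_congr rfl fun k _ => by ring
  rw [h5, h4]
  have h6 : 2 * (1 / (2 * d * (N : ℝ) ^ d) * (d * ∑ k : Torus d N,
      torusEig k * Real.exp (-(torusEig k * u)) * cycleEig (k i))) =
      1 / (N : ℝ) ^ d * ∑ k : Torus d N,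
      torusEig k * Real.exp (-(torusEig k * u)) * cycleEig (k i) := by
    generalize ∑ k : Torus d N,
      torusEig k * Real.exp (-(torusEig k * u)) * cycleEig (k i) = X
    field_simp
  rw [h6]
  linarith

/-- Duhamel's formula for a perturbation of the heat equation on the torus that is supported near
the origin. -/
theorem neg_torusLap_eq_decayProfile_add (hd : 1 ≤ d) {Q : ℝ → Torus d N → ℝ}
    {G : ℝ → Fin d → ℝ} (hG : ∀ i, Continuous fun s => G s i)
    (hQ : ∀ s z, HasDerivAt (fun s => Q s z) (torusLap (Q s) z + 1 / 2 * ∑ i, G s i *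
      (2 * (if z = 0 then 1 else 0) - (if z = Pi.single i 1 then 1 else 0) -
        (if z = -Pi.single i 1 then 1 else 0))) s)
    (h0 : ∀ z, Q 0 z = if z = 0 then 1 else 0) (t : ℝ) :
    -torusLap (Q t) 0 = 2 * d * decayProfile d N t +
      ∫ s in (0 : ℝ)..t, decayRate d N (t - s) * ∑ i, G s i := by
  -- The two Laplacian terms cancel by self-adjointness, so only the source survives. The endpoints
  -- `s = t` and `s = 0` give `-torusLap (Q t) 0` and the free term.
  have hder : ∀ s, HasDerivAt (fun s => ∑ z, Q s z * heatFlux d N (t - s) z)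
      (decayRate d N (t - s) * ∑ i, G s i) s := by
    intro s
    have hW : ∀ z : Torus d N, HasDerivAt (fun s => heatFlux d N (t - s) z)
        (-torusLap (heatFlux d N (t - s)) z) s := by
      intro z
      have := (hasDerivAt_heatFlux (t - s) z).comp s ((hasDerivAt_id s).const_sub t)
      exact this.congr_deriv (by simp)
    have h1 := HasDerivAt.fun_sum fun z (_ : z ∈ Finset.univ) => (hQ s z).mul (hW z)
    refine h1.congr_deriv ?_
    have h2 := sum_torusLap_mul (Q s) (heatFlux d N (t - s))
    simp only [add_mul, mul_neg, Finset.sum_add_distrib, Finset.sum_neg_distrib]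
    rw [h2]
    have h3 : ∑ z, 1 / 2 * (∑ i, G s i *
        (2 * (if z = 0 then 1 else 0) - (if z = Pi.single i 1 then 1 else 0) -
          (if z = -Pi.single i 1 then 1 else 0))) * heatFlux d N (t - s) z =
        1 / 2 * ∑ i, G s i * (2 * heatFlux d N (t - s) 0 - heatFlux d N (t - s) (Pi.single i 1) -
          heatFlux d N (t - s) (-Pi.single i 1)) := by
      simp only [mul_assoc, ← Finset.mul_sum, Finset.sum_mul]
      rw [Finset.sum_comm]
      congr 1
      refine Finset.sum_congr rfl fun i _ => ?_
      rw [← Finset.mul_sum]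
      congr 1
      simp [sub_mul, Finset.sum_sub_distrib, ite_mul]
    rw [h3]
    simp only [heatFlux_second_diff_zero hd]
    rw [← Finset.sum_mul]
    ring
  have hcont : Continuous fun s => decayRate d N (t - s) * ∑ i, G s i :=
    (continuous_decayRate.comp (by fun_prop)).mul (continuous_finsetSum _ fun i _ => hG i)
  have h1 := intervalIntegral.integral_eq_sub_of_hasDerivAt (a := 0) (b := t)
    (fun s _ => hder s) (hcont.intervalIntegrable _ _)
  have h2 : ∑ z, Q t z * heatFlux d N (t - t) z = -torusLap (Q t) 0 := by
    simp only [sub_self, heatFlux_zero_time, mul_neg, Finset.sum_neg_distrib]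
    rw [← sum_torusLap_mul]
    simp
  have h3 : ∑ z, Q 0 z * heatFlux d N (t - 0) z = 2 * d * decayProfile d N t := by
    simp [h0, heatFlux_at_zero hd]
  rw [h2, h3] at h1
  rw [h1]
  ring

end HeatKernel

/-! ### Estimates for the decay profile -/

section Profile

theorem single_ne_zero_of_two_le {d N : ℕ} (hN : 2 ≤ N) (i : Fin d) : (Pi.single i 1 : Torus d N) ≠ 0 := by
  have : Fact (1 < N) := ⟨hN⟩
  simp

variable {d N : ℕ} [NeZero N]

theorem decayCoeff_nonneg (k : Torus d N) : 0 ≤ torusEig k / (2 * d * (N : ℝ) ^ d) :=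
  div_nonneg (torusEig_nonneg k) (by positivity)

/-- Minus the Laplacian of the point mass is `2 * d` at the origin, which also evaluates the
eigenvalue sum `sum_torusEig`. -/
theorem decayProfile_zero (hd : 1 ≤ d) (hN : 2 ≤ N) : decayProfile d N 0 = 1 := by
  have h1 := heatFlux_at_zero (N := N) hd 0
  rw [heatFlux_zero_time, torusLap] at h1
  simp only [zero_add, zero_sub, neg_eq_zero, single_ne_zero_of_two_le hN, if_false, if_true] at h1
  have hd' : (0 : ℝ) < d := by positivity
  simp only [Finset.sum_const, Finset.card_univ, Fintype.card_fin, nsmul_eq_mul] at h1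
  have h2 : 2 * (d : ℝ) * (decayProfile d N 0 - 1) = 0 := by linarith
  rcases mul_eq_zero.1 h2 with h3 | h3
  · linarith
  · linarith

theorem sum_torusEig (hd : 1 ≤ d) (hN : 2 ≤ N) :
    ∑ k : Torus d N, torusEig k = 2 * d * (N : ℝ) ^ d := by
  have h1 := decayProfile_zero hd hN
  have := natCast_pos_of_neZero (N := N)
  have hd' : (0 : ℝ) < d := by positivity
  simp only [decayProfile, expSum, mul_zero, neg_zero, Real.exp_zero, mul_one] at h1
  rw [← Finset.sum_div, div_eq_one_iff_eq (by positivity)] at h1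
  exact h1

theorem decayProfile_pos (hd : 1 ≤ d) (hN : 2 ≤ N) (t : ℝ) : 0 < decayProfile d N t := by
  have h1 := le_torusEig (single_ne_zero_of_two_le (d := d) hN ⟨0, hd⟩)
  have := natCast_pos_of_neZero (N := N)
  have h2 : 0 < torusEig (Pi.single ⟨0, hd⟩ 1 : Torus d N) := lt_of_lt_of_le (by positivity) h1
  have hd' : (0 : ℝ) < d := by positivity
  exact Finset.sum_pos' (fun k _ => mul_nonneg (decayCoeff_nonneg k) (Real.exp_pos _).le)
    ⟨_, Finset.mem_univ _, mul_pos (div_pos h2 (by positivity)) (Real.exp_pos _)⟩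

theorem decayRate_nonneg (t : ℝ) : 0 ≤ decayRate d N t :=
  expSum_nonneg (fun k => mul_nonneg (decayCoeff_nonneg k) (torusEig_nonneg k)) _ _

theorem decayRate_le (t : ℝ) : decayRate d N t ≤ 4 * d * decayProfile d N t := by
  rw [decayRate, decayProfile, expSum, expSum, Finset.mul_sum]
  refine Finset.sum_le_sum fun k _ => ?_
  have h1 := mul_nonneg (decayCoeff_nonneg k) (Real.exp_pos (-(torusEig k * t))).le
  have h2 := torusEig_le k
  nlinarith

theorem integral_decayProfile_le (hd : 1 ≤ d) (t : ℝ) :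
    ∫ s in (0 : ℝ)..t, decayProfile d N s ≤ 1 := by
  have hN := natCast_pos_of_neZero (N := N)
  have hd' : (1 : ℝ) ≤ d := by exact_mod_cast hd
  have h1 := integral_expSum_le (a := fun _ : Torus d N => 1 / (2 * d * (N : ℝ) ^ d))
    (l := torusEig) (fun k => by positivity) t
  simp only [one_div_mul_eq_div] at h1
  refine h1.trans ?_
  simp only [Finset.sum_const, Finset.card_univ, Fintype.card_pi, ZMod.card, Finset.prod_const,
    Fintype.card_fin, nsmul_eq_mul, Nat.cast_pow]
  rw [mul_one_div, div_le_one (by positivity)]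
  have : 0 < (N : ℝ) ^ d := by positivity
  nlinarith

theorem one_sub_decayProfile_ge (hd : 1 ≤ d) (hN : 2 ≤ N) {t : ℝ} (ht : 0 ≤ t) :
    1 / (1 + 4 * d) * min t 1 ≤ 1 - decayProfile d N t := by
  have hNp := natCast_pos_of_neZero (N := N)
  have hd' : (1 : ℝ) ≤ d := by exact_mod_cast hd
  have h1 := one_sub_expSum_ge (c := fun k : Torus d N => torusEig k / (2 * d * (N : ℝ) ^ d))
    decayCoeff_nonneg torusEig_nonneg torusEig_le (decayProfile_zero hd hN)
    (le_min ht zero_le_one) (min_le_right t 1)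
  -- Cauchy–Schwarz with the known sum of eigenvalues bounds the initial decay rate below by `2 *
  -- d`.
  have h2 : 1 ≤ ∑ k : Torus d N, torusEig k / (2 * d * (N : ℝ) ^ d) * torusEig k := by
    have h3 := sq_sum_le_card_mul_sum_sq (s := Finset.univ) (f := fun k : Torus d N => torusEig k)
    rw [sum_torusEig hd hN] at h3
    simp only [Finset.card_univ, Fintype.card_pi, ZMod.card, Finset.prod_const,
      Fintype.card_fin, Nat.cast_pow] at h3
    have h4 : ∑ k : Torus d N, torusEig k / (2 * d * (N : ℝ) ^ d) * torusEig k =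
        (∑ k : Torus d N, torusEig k ^ 2) / (2 * d * (N : ℝ) ^ d) := by
      rw [Finset.sum_div]
      exact Finset.sum_congr rfl fun k _ => by ring
    have h5 : 0 < (N : ℝ) ^ d := by positivity
    rw [h4, le_div_iff₀ (by positivity), one_mul]
    have h6 : (N : ℝ) ^ d * (4 * d ^ 2 * (N : ℝ) ^ d) ≤
        (N : ℝ) ^ d * ∑ k : Torus d N, torusEig k ^ 2 := by
      refine le_trans (le_of_eq ?_) h3
      ring
    have h7 := le_of_mul_le_mul_left h6 h5
    have h8 : 0 ≤ (d : ℝ) * (N : ℝ) ^ d * (2 * d - 1) :=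
      mul_nonneg (by positivity) (by linarith)
    nlinarith
  have h8 : decayProfile d N t ≤ decayProfile d N (min t 1) :=
    antitone_of_neg_deriv_nonneg hasDerivAt_decayProfile decayRate_nonneg (min_le_left _ _)
  have h9 : 0 ≤ min t 1 / (1 + 4 * (d : ℝ)) := div_nonneg (le_min ht zero_le_one) (by positivity)
  have h10 : min t 1 / (1 + 4 * (d : ℝ)) * 1 ≤ 1 - decayProfile d N (min t 1) :=
    (mul_le_mul_of_nonneg_left h2 h9).trans h1
  calc _ = min t 1 / (1 + 4 * (d : ℝ)) * 1 := by ring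
    _ ≤ _ := h10.trans (by linarith)

theorem decayProfile_half_le {t : ℝ} (ht0 : 0 ≤ t) (ht : t ≤ (N : ℝ) ^ 2) :
    decayProfile d N (t / 2) ≤ 63 * Real.exp 40 ^ d * 5 ^ d * decayProfile d N t := by
  have h1 : ∀ t, decayProfile d N t = 1 / (2 * d * (N : ℝ) ^ d) *
      ∑ k : Torus d N, torusEig k * Real.exp (-(torusEig k * t)) := by
    intro t
    rw [decayProfile, expSum, Finset.mul_sum]
    exact Finset.sum_congr rfl fun k _ => by ring
  rw [h1, h1]
  have h2 := mul_le_mul_of_nonneg_left (sum_torusEig_exp_doubling (d := d) ht0 ht)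
    (by positivity : 0 ≤ 1 / (2 * d * (N : ℝ) ^ d))
  refine h2.trans (le_of_eq ?_)
  ring

/-- Up to `N ^ 2` this is doubling; afterwards the logarithmic decay rate can only decrease. -/
theorem decayRate_le_div (hd : 1 ≤ d) (hN : 2 ≤ N) {t : ℝ} (ht : 0 < t) :
    decayRate d N t ≤
      2 * (63 * Real.exp 40 ^ d * 5 ^ d) / min t ((N : ℝ) ^ 2) * decayProfile d N t := by
  have hNp := natCast_pos_of_neZero (N := N)
  have key : ∀ t : ℝ, 0 < t → t ≤ (N : ℝ) ^ 2 →
      decayRate d N t ≤ 2 * (63 * Real.exp 40 ^ d * 5 ^ d) / t * decayProfile d N t := by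
    intro t ht htN
    have h1 : decayRate d N t ≤ 2 / t * decayProfile d N (t / 2) :=
      expSum_mul_le_half decayCoeff_nonneg ht
    have h2 := mul_le_mul_of_nonneg_left (decayProfile_half_le (d := d) ht.le htN)
      (by positivity : 0 ≤ 2 / t)
    exact h1.trans (h2.trans (le_of_eq (by ring)))
  rcases le_total t ((N : ℝ) ^ 2) with h | h
  · rw [min_eq_left h]
    exact key t ht h
  · rw [min_eq_right h]
    have h1 := key _ (by positivity) le_rfl
    have h2 : decayRate d N t * decayProfile d N ((N : ℝ) ^ 2) ≤
        decayRate d N ((N : ℝ) ^ 2) * decayProfile d N t :=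
      expSum_logDeriv_mono decayCoeff_nonneg h
    have h3 := mul_le_mul_of_nonneg_right h1 (decayProfile_pos hd hN t).le
    refine le_of_mul_le_mul_right ?_ (decayProfile_pos hd hN ((N : ℝ) ^ 2))
    calc _ ≤ _ := h2
      _ ≤ _ := h3
      _ = _ := by ring

/-- At time `N ^ 2` the profile is `O(N ^ (-(d + 2)))`, and the coefficient of the spectral gap mode
is at least of that order. The constant of `expSum_mul_expSum_le`, a square over a coefficient, then
has this order too. -/
theorem exists_decayProfile_mul_le (hd : 1 ≤ d) : ∃ C : ℝ, 0 < C ∧ ∀ (N : ℕ) [NeZero N], 2 ≤ N →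
    ∀ s u : ℝ, (N : ℝ) ^ 2 ≤ s → (N : ℝ) ^ 2 ≤ u →
      decayProfile d N s * decayProfile d N u ≤
        C / (N : ℝ) ^ (d + 2) * decayProfile d N (s + u) := by
  obtain ⟨C, hC, hCN⟩ := exists_sum_exp_cycleEig_le
  have hd' : (1 : ℝ) ≤ d := by exact_mod_cast hd
  refine ⟨Real.exp (8 * d * 40) * C ^ (2 * d), by positivity, fun N _ hN s u hs hu => ?_⟩
  have hNp := natCast_pos_of_neZero (N := N)
  have hne := single_ne_zero_of_two_le (d := d) hN ⟨0, hd⟩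
  set e : Torus d N := Pi.single ⟨0, hd⟩ 1 with he
  obtain ⟨k₀, hk₀, hmin⟩ := Finset.exists_min_image (Finset.univ.filter fun k : Torus d N => k ≠ 0)
    torusEig ⟨e, by simpa using hne⟩
  simp only [Finset.mem_filter, Finset.mem_univ, true_and] at hk₀ hmin
  have hlow := le_torusEig hk₀
  have hupp : torusEig k₀ ≤ 40 / (N : ℝ) ^ 2 := by
    refine (hmin e hne).trans ?_
    rw [torusEig, Finset.sum_eq_single (⟨0, hd⟩ : Fin d)
      (fun i _ hi => by rw [he, Pi.single_eq_of_ne hi, cycleEig_zero]) (by simp), he,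
      Pi.single_eq_same]
    have := cycleEig_intCast_le (N := N) 1
    simpa using this
  have hk0pos : 0 < torusEig k₀ := lt_of_lt_of_le (by positivity) hlow
  have hc0 : 0 < torusEig k₀ / (2 * d * (N : ℝ) ^ d) := by positivity
  have h1 := expSum_mul_expSum_le (c := fun k : Torus d N => torusEig k / (2 * d * (N : ℝ) ^ d))
    (l := torusEig) (k₀ := k₀) decayCoeff_nonneg (fun k hk => hmin k fun h => hk (by
      simp [h, torusEig_zero])) hc0 hs hu
  refine h1.trans (mul_le_mul_of_nonneg_right ?_ (decayProfile_pos hd hN _).le)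
  have h2 : decayProfile d N ((N : ℝ) ^ 2) ≤ C ^ d / (d * (N : ℝ) ^ d * (N : ℝ) ^ 2) := by
    have h3 := expSum_mul_le_half (c := fun _ : Torus d N => 1 / (2 * d * (N : ℝ) ^ d))
      (l := torusEig) (t := (N : ℝ) ^ 2) (fun _ => by positivity) (by positivity)
    simp only [one_div_mul_eq_div] at h3
    refine h3.trans ?_
    rw [expSum, ← Finset.mul_sum, sum_exp_torusEig]
    have h4 := pow_le_pow_left₀ (Finset.sum_nonneg fun j _ => (Real.exp_pos _).le) (hCN N) d
    calc _ ≤ 2 / (N : ℝ) ^ 2 * (1 / (2 * d * (N : ℝ) ^ d) * C ^ d) := by gcongr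
      _ = _ := by field_simp
  have h5 : Real.exp (2 * (torusEig k₀ * (N : ℝ) ^ 2)) ≤ Real.exp (8 * d * 40) := by
    rw [Real.exp_le_exp]
    have : torusEig k₀ * (N : ℝ) ^ 2 ≤ 40 := by rwa [le_div_iff₀ (by positivity)] at hupp
    nlinarith
  rw [div_le_iff₀ hc0]
  have h6 := (decayProfile_pos hd hN ((N : ℝ) ^ 2)).le
  calc _ ≤ Real.exp (8 * d * 40) * (C ^ d / (d * (N : ℝ) ^ d * (N : ℝ) ^ 2)) ^ 2 := by
        gcongr
        exact h2
    _ = Real.exp (8 * d * 40) * C ^ (2 * d) / (N : ℝ) ^ (d + 2) *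
          (1 / (N : ℝ) ^ 2 / (d ^ 2 * (N : ℝ) ^ d)) := by
        rw [pow_add, mul_comm 2 d, pow_mul]
        field_simp
    _ ≤ _ := by
        gcongr ?_ * ?_
        have h7 : 1 / (N : ℝ) ^ 2 ≤ torusEig k₀ / 16 := by
          have : 1 / (N : ℝ) ^ 2 = 16 / (N : ℝ) ^ 2 / 16 := by ring
          rw [this]; gcongr
        calc 1 / (N : ℝ) ^ 2 / (d ^ 2 * (N : ℝ) ^ d) ≤
            torusEig k₀ / 16 / (d ^ 2 * (N : ℝ) ^ d) := by gcongr
          _ = torusEig k₀ / (16 * d ^ 2 * (N : ℝ) ^ d) := by field_simp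
          _ ≤ _ := by
            have h8 : 2 * (d : ℝ) ≤ 16 * d ^ 2 := by nlinarith
            gcongr

theorem exists_renewal_comparison (hd : 1 ≤ d) : ∃ B C₁ C₂ : ℝ, 0 < B ∧ 0 < C₁ ∧ 0 < C₂ ∧
    ∃ N₀ : ℕ, ∀ (N : ℕ) [NeZero N], N₀ ≤ N → ∀ g : ℝ → ℝ, Continuous g →
      (∀ t, 0 ≤ t → 0 ≤ g t) →
      (∀ t, 0 ≤ t → g t = decayProfile d N t +
        1 / 2 * ∫ s in (0 : ℝ)..t, decayRate d N s * g (t - s)) →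
      ∀ t, 0 ≤ t → (1 + C₁ * min t 1) * decayProfile d N t ≤ g t ∧
        g t ≤ C₂ * Real.exp (B * t / (N : ℝ) ^ (d + 2)) * decayProfile d N t := by
  obtain ⟨C, hC, hmul⟩ := exists_decayProfile_mul_le hd
  have hd' : (1 : ℝ) ≤ d := by exact_mod_cast hd
  set R : ℝ := 2 * (63 * Real.exp 40 ^ d * 5 ^ d) with hR
  have hR1 : 1 ≤ R := by
    have h1 : 1 ≤ Real.exp 40 ^ d := one_le_pow₀ (Real.one_le_exp (by norm_num))
    have h2 : (1 : ℝ) ≤ 5 ^ d := one_le_pow₀ (by norm_num)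
    have := one_le_mul_of_one_le_of_one_le h1 h2
    rw [hR]; linarith
  obtain ⟨n, hn⟩ := exists_nat_ge (60 * R * Real.exp R)
  -- Here `B / N ^ (d + 2)` is the least admissible tilt `12 * Λ * K`, with `Λ = 4 * d` and `K = C /
  -- N ^ (d + 2)`.
  refine ⟨12 * (4 * d * C), 1 / 2 * (1 / (1 + 4 * d)),
    2 * Real.exp (4 * d * (120 * R * Real.exp R)) + 4, by positivity, by positivity, by positivity,
    max n 2, fun N _ hN g gc g0 hg t ht => ?_⟩
  have hN2 : 2 ≤ N := (le_max_right _ _).trans hN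
  have hNp := natCast_pos_of_neZero (N := N)
  constructor
  · refine le_trans ?_ (renewal_lower_bound hasDerivAt_decayProfile continuous_decayRate
      decayRate_nonneg (decayProfile_zero hd hN2) gc g0 hg ht)
    have h1 := one_sub_decayProfile_ge hd hN2 ht
    refine mul_le_mul_of_nonneg_right ?_ (decayProfile_pos hd hN2 t).le
    rw [mul_assoc]
    gcongr
  · have hNR : 60 * R * Real.exp R ≤ (N : ℝ) ^ 2 := by
      have h1 : (n : ℝ) ≤ N := by exact_mod_cast (le_max_left _ _).trans hN
      have h2 : (1 : ℝ) ≤ N := by exact_mod_cast (by omega : 1 ≤ N)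
      nlinarith
    have h1 := renewal_upper_bound (ε := 12 * (4 * d * C) / (N : ℝ) ^ (d + 2))
      hasDerivAt_decayProfile continuous_decayRate decayRate_nonneg (decayProfile_pos hd hN2)
      (decayProfile_zero hd hN2) (fun t _ => integral_decayProfile_le hd t)
      (fun t ht => decayRate_le_div hd hN2 ht) decayRate_le (hmul N hN2) hR1 (by positivity)
      (by positivity) (le_of_eq (by ring)) hNR gc g0 hg ht
    rwa [div_mul_eq_mul_div] at h1

end Profile

/-! ### Autocorrelation of functions on the torus -/

section Correlation

variable {d N : ℕ} [NeZero N]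

/-- The autocorrelation `z ↦ ∑_x η x η (x + z)`. -/
def autocorr (η : Torus d N → ℝ) (z : Torus d N) : ℝ := ∑ x, η x * η (x + z)

theorem sum_comp_add_right (f : Torus d N → ℝ) (a : Torus d N) : ∑ x, f (x + a) = ∑ x, f x :=
  Equiv.sum_comp (Equiv.addRight a) f

theorem autocorr_neg (η : Torus d N → ℝ) (z : Torus d N) : autocorr η (-z) = autocorr η z := by
  rw [autocorr, ← sum_comp_add_right _ z]
  simp only [add_neg_cancel_right]
  exact Finset.sum_congr rfl fun x _ => mul_comm _ _

theorem sum_diff_mul_diff (η : Torus d N → ℝ) (z e : Torus d N) :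
    ∑ x, (η x - η (x + e)) * (η (x + z) - η (x + z + e)) =
      2 * autocorr η z - autocorr η (z + e) - autocorr η (z - e) := by
  have h1 : ∑ x, η (x + e) * η (x + z) = autocorr η (z - e) := by
    rw [autocorr, ← sum_comp_add_right (fun x => η x * η (x + (z - e))) e]
    exact Finset.sum_congr rfl fun x _ => by rw [show x + e + (z - e) = x + z by abel]
  have h2 : ∑ x, η (x + e) * η (x + z + e) = autocorr η z := by
    rw [autocorr, ← sum_comp_add_right (fun x => η x * η (x + z)) e]
    exact Finset.sum_congr rfl fun x _ => by rw [add_right_comm]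
  have h3 : ∑ x, η x * η (x + z + e) = autocorr η (z + e) := by
    rw [autocorr]
    exact Finset.sum_congr rfl fun x _ => by rw [add_assoc]
  simp only [sub_mul, mul_sub, Finset.sum_sub_distrib]
  rw [h1, h2, h3, ← autocorr]
  ring

theorem sum_diff_sq (η : Torus d N → ℝ) (e : Torus d N) :
    ∑ x, (η x - η (x + e)) ^ 2 = 2 * (autocorr η 0 - autocorr η e) := by
  have h := sum_diff_mul_diff η 0 e
  simp only [add_zero, zero_add, zero_sub, autocorr_neg] at h
  simp only [pow_two]
  rw [h]
  ring

theorem torusLap_autocorr_zero (η : Torus d N → ℝ) :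
    -torusLap (autocorr η) 0 = 2 * ∑ i, (autocorr η 0 - autocorr η (Pi.single i 1)) := by
  rw [torusLap, Finset.mul_sum, ← Finset.sum_neg_distrib]
  refine Finset.sum_congr rfl fun i _ => ?_
  rw [zero_add, zero_sub, autocorr_neg]
  ring

open Classical in
-- For `N = 2` the two neighbors in a direction coincide and would be counted twice.
theorem sum_adj (hN : 3 ≤ N) (x : Torus d N) (f : Torus d N → ℝ) :
    ∑ y : Torus d N with (torusGraph d N).Adj x y, f y =
      ∑ i, (f (x + Pi.single i 1) + f (x - Pi.single i 1)) := by
  have h1ne : (1 : ZMod N) ≠ 0 := by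
    have : Fact (1 < N) := ⟨by omega⟩
    exact one_ne_zero
  have h2ne : (1 : ZMod N) ≠ -1 := by
    intro h
    have h2 : ((2 : ℕ) : ZMod N) = 0 := by
      push_cast
      linear_combination h
    rw [ZMod.natCast_eq_zero_iff] at h2
    have := Nat.le_of_dvd (by norm_num) h2
    omega
  let E : Fin d × Bool → Torus d N := fun p =>
    x + (if p.2 then Pi.single p.1 1 else -Pi.single p.1 1)
  have hE : Function.Injective E := by
    rintro ⟨i, b⟩ ⟨j, c⟩ h
    simp only [E, add_right_inj] at h
    have hi := congrFun h i
    by_cases hij : i = j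
    · subst hij
      cases b <;> cases c <;> simp at hi ⊢
      · exact h2ne hi.symm
      · exact h2ne hi
    · exfalso
      cases b <;> cases c <;> simp [Pi.single_eq_of_ne hij, h1ne] at hi
  have himg : (Finset.univ.filter fun y => (torusGraph d N).Adj x y) = Finset.univ.image E := by
    ext y
    simp only [Finset.mem_filter, Finset.mem_univ, true_and, Finset.mem_image, torusGraph,
      SimpleGraph.fromRel_adj, Prod.exists, E]
    constructor
    · rintro ⟨_, ⟨i, rfl⟩ | ⟨i, h⟩⟩
      · exact ⟨i, true, by simp⟩
      · exact ⟨i, false, by rw [h]; simp⟩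
    · rintro ⟨i, b, rfl⟩
      have hne := single_ne_zero_of_two_le (N := N) (by omega) i
      cases b
      · exact ⟨by simp [h1ne], Or.inr ⟨i, by simp⟩⟩
      · exact ⟨by simp [h1ne], Or.inl ⟨i, by simp⟩⟩
  rw [himg, Finset.sum_image fun p _ q _ h => hE h, Fintype.sum_prod_type]
  refine Finset.sum_congr rfl fun i _ => ?_
  simp [E, sub_eq_add_neg]

theorem dirichletForm_div_unif (hN : 3 ≤ N) (η : Torus d N → ℝ) :
    dirichletForm (fun x => η x / unif d N x) =
      (N : ℝ) ^ d * ∑ i, (autocorr η 0 - autocorr η (Pi.single i 1)) := by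
  have hNp := natCast_pos_of_neZero (N := N)
  rw [dirichletForm]
  simp only [sum_adj hN, unif, div_div_eq_mul_div, div_one]
  have h1 : ∀ i : Fin d, ∑ x : Torus d N, (η x - η (x - Pi.single i 1)) ^ 2 =
      ∑ x, (η x - η (x + Pi.single i 1)) ^ 2 := by
    intro i
    rw [← sum_comp_add_right _ (Pi.single i 1)]
    exact Finset.sum_congr rfl fun x _ => by rw [add_sub_cancel_right]; ring
  rw [Finset.sum_comm, Finset.mul_sum, Finset.mul_sum]
  refine Finset.sum_congr rfl fun i _ => ?_
  simp only [← sub_mul, mul_pow]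
  rw [Finset.sum_add_distrib, ← Finset.sum_mul, ← Finset.sum_mul, h1, sum_diff_sq]
  field_simp
  ring

theorem avgFun_eq_sub {V : Type*} [DecidableEq V] (x y : V) (η : V → ℝ) (w : V) :
    avgFun x y η w =
      η w - (η x - η y) / 2 * ((if w = x then 1 else 0) - (if w = y then 1 else 0)) := by
  unfold avgFun
  by_cases hx : w = x
  · by_cases hy : w = y
    · subst hx; subst hy; simp
    · subst hx; simp [hy]; ring
  · by_cases hy : w = y
    · subst hy; simp [hx]; ring
    · simp [hx, hy]

/-- Averaging subtracts `(η x - η y) / 2` times `δ_x - δ_y`. The linear terms become the Laplacian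
after summation over edges, the quadratic term the source. -/
theorem autocorr_avgFun (x y : Torus d N) (η : Torus d N → ℝ) (z : Torus d N) :
    autocorr (avgFun x y η) z - autocorr η z =
      -(1 / 2 * ((η x - η y) *
        ((η (x + z) - η (y + z)) + (η (x - z) - η (y - z))))) +
      1 / 4 * ((η x - η y) ^ 2 * (2 * (if z = 0 then 1 else 0) - (if z = y - x then 1 else 0) -
        (if z = -(y - x) then 1 else 0))) := by
  set D := η x - η y with hD
  set v : Torus d N → ℝ := fun w => (if w = x then 1 else 0) - (if w = y then 1 else 0) with hv
  have h1 : ∀ f : Torus d N → ℝ, ∑ w, v w * f w = f x - f y := by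
    intro f
    simp [hv, sub_mul, Finset.sum_sub_distrib]
  have h2 : ∑ w, η w * v (w + z) = η (x - z) - η (y - z) := by
    rw [← h1 (fun w => η (w - z)), ← sum_comp_add_right (fun w => v w * η (w - z)) z]
    exact Finset.sum_congr rfl fun w _ => by rw [add_sub_cancel_right, mul_comm]
  have h3 : v (x + z) - v (y + z) = 2 * (if z = 0 then 1 else 0) - (if z = y - x then 1 else 0) -
      (if z = -(y - x) then 1 else 0) := by
    have e1 : x + z = y ↔ z = y - x := by rw [eq_sub_iff_add_eq, add_comm]
    have e2 : y + z = x ↔ z = -(y - x) := by rw [neg_sub, eq_sub_iff_add_eq, add_comm]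
    simp only [hv, add_eq_left, e1, e2]
    ring
  rw [← h3]
  have h4 : autocorr (avgFun x y η) z = autocorr η z - D / 2 * ∑ w, v w * η (w + z) -
      D / 2 * ∑ w, η w * v (w + z) + D ^ 2 / 4 * ∑ w, v w * v (w + z) := by
    simp only [autocorr, Finset.mul_sum, ← Finset.sum_sub_distrib, ← Finset.sum_add_distrib]
    refine Finset.sum_congr rfl fun w _ => ?_
    rw [avgFun_eq_sub, avgFun_eq_sub]
    simp only [hv, hD]
    ring
  rw [h4, h1 fun w => η (w + z), h2, h1 fun w => v (w + z)]
  ring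

theorem sum_autocorr_avgFun_add (η : Torus d N → ℝ) (z e : Torus d N) :
    ∑ x, (autocorr (avgFun x (x + e) η) z - autocorr η z) =
      (autocorr η (z + e) + autocorr η (z - e) - 2 * autocorr η z) +
      1 / 2 * ((autocorr η 0 - autocorr η e) *
        (2 * (if z = 0 then 1 else 0) - (if z = e then 1 else 0) -
          (if z = -e then 1 else 0))) := by
  simp only [autocorr_avgFun, add_sub_cancel_left]
  rw [Finset.sum_add_distrib, Finset.sum_neg_distrib, ← Finset.mul_sum, ← Finset.mul_sum,
    ← Finset.sum_mul, sum_diff_sq]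
  simp only [mul_add, Finset.sum_add_distrib]
  have h1 : ∑ x, (η x - η (x + e)) * (η (x + z) - η (x + e + z)) =
      2 * autocorr η z - autocorr η (z + e) - autocorr η (z - e) := by
    rw [← sum_diff_mul_diff]
    exact Finset.sum_congr rfl fun x _ => by rw [add_right_comm]
  have h2 : ∑ x, (η x - η (x + e)) * (η (x - z) - η (x + e - z)) =
      2 * autocorr η z - autocorr η (z + e) - autocorr η (z - e) := by
    rw [← sum_diff_mul_diff, ← sum_comp_add_right _ z]
    refine Finset.sum_congr rfl fun x _ => ?_
    rw [add_sub_cancel_right, mul_comm, show x + z + e - z = x + e by abel]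
  rw [h1, h2]
  ring

theorem sum_autocorr_avgFun_sub (η : Torus d N → ℝ) (z e : Torus d N) :
    ∑ x, (autocorr (avgFun x (x - e) η) z - autocorr η z) =
      ∑ x, (autocorr (avgFun x (x + e) η) z - autocorr η z) := by
  rw [sum_autocorr_avgFun_add, sub_eq_add_neg z e]
  simp only [sub_eq_add_neg _ e]
  rw [sum_autocorr_avgFun_add, autocorr_neg, sub_neg_eq_add, neg_neg, ← sub_eq_add_neg z e]
  ring

/-- The autocorrelation at `z` as a continuous function of the mass distribution. -/
def autocorrMap (z : Torus d N) : C(MassSpace d N, ℝ) where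
  toFun η := autocorr η.1 z
  continuous_toFun := by
    have h : ∀ w : Torus d N, Continuous fun η : MassSpace d N => η.1 w :=
      fun w => (continuous_apply w).comp continuous_subtype_val
    exact continuous_finsetSum _ fun x _ => (h x).mul (h _)

theorem autocorrMap_apply (z : Torus d N) (η : MassSpace d N) :
    autocorrMap z η = autocorr η.1 z := rfl

theorem avgGenerator_autocorrMap (hN : 3 ≤ N) (z : Torus d N) :
    avgGenerator d N (autocorrMap z) =
      ∑ i, (autocorrMap (z + Pi.single i 1) + autocorrMap (z - Pi.single i 1) -
        (2 : ℝ) • autocorrMap z) +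
      (1 / 2 : ℝ) • ∑ i, (2 * (if z = 0 then 1 else 0) - (if z = Pi.single i 1 then 1 else 0) -
        (if z = -Pi.single i 1 then 1 else 0) : ℝ) •
          (autocorrMap 0 - autocorrMap (Pi.single i 1)) := by
  ext η
  rw [avgGenerator_apply]
  simp only [sum_adj hN]
  rw [Finset.sum_comm]
  have h1 : ∀ i : Fin d, ∑ x : Torus d N,
      (autocorrMap z (avgMap x (x + Pi.single i 1) η) - autocorrMap z η +
        (autocorrMap z (avgMap x (x - Pi.single i 1) η) - autocorrMap z η)) =
      2 * ∑ x : Torus d N, (autocorr (avgFun x (x + Pi.single i 1) η.1) z - autocorr η.1 z) := by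
    intro i
    rw [Finset.sum_add_distrib]
    have := sum_autocorr_avgFun_sub η.1 z (Pi.single i 1)
    rw [two_mul]
    exact congrArg₂ (· + ·) rfl this
  simp only [h1, sum_autocorr_avgFun_add]
  simp only [ContinuousMap.add_apply, ContinuousMap.smul_apply, ContinuousMap.sum_apply,
    ContinuousMap.sub_apply, smul_eq_mul]
  rw [← Finset.mul_sum, Finset.mul_sum (a := (1 / 2 : ℝ)) (s := Finset.univ (α := Fin d)),
    ← Finset.sum_add_distrib, ← mul_assoc]
  norm_num
  exact Finset.sum_congr rfl fun i _ => by
    simp only [autocorrMap_apply]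
    ring

end Correlation

/-! ### Semigroups and expectations -/

section Semigroup

/-- The one-parameter group generated by a bounded operator. -/
noncomputable def expGroup {F : Type*} [NormedAddCommGroup F] [NormedSpace ℝ F]
    (G : F →L[ℝ] F) (t : ℝ) : F →L[ℝ] F :=
  NormedSpace.exp (t • G)

theorem expGroup_zero {F : Type*} [NormedAddCommGroup F] [NormedSpace ℝ F] (G : F →L[ℝ] F) (f : F) :
    expGroup G 0 f = f := by
  rw [expGroup, zero_smul, NormedSpace.exp_zero]
  rfl

theorem hasDerivAt_expGroup {F : Type*} [NormedAddCommGroup F] [NormedSpace ℝ F] [CompleteSpace F]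
    (G : F →L[ℝ] F) (f : F) (s : ℝ) :
    HasDerivAt (fun s => expGroup G s f) (expGroup G s (G f)) s := by
  have h1 := hasDerivAt_exp_smul_const (𝕂 := ℝ) G s
  have h2 := h1.clm_apply (hasDerivAt_const s f)
  simp only [map_zero, add_zero] at h2
  exact h2

theorem hasDerivAt_expGroup_apply {E : Type*} [TopologicalSpace E] [CompactSpace E]
    (G : C(E, ℝ) →L[ℝ] C(E, ℝ)) (f : C(E, ℝ)) (ξ : E) (s : ℝ) :
    HasDerivAt (fun s : ℝ => expGroup G s f ξ) (expGroup G s (G f) ξ) s := by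
  have h1 : HasFDerivAt (fun g : C(E, ℝ) => g ξ) (ContinuousMap.evalCLM ℝ ξ : C(E, ℝ) →L[ℝ] ℝ)
      (expGroup G s f) := (ContinuousMap.evalCLM ℝ ξ : C(E, ℝ) →L[ℝ] ℝ).hasFDerivAt
  exact h1.comp_hasDerivAt s (hasDerivAt_expGroup G f s)

/-- The Markov property at time `0`, integrated, with the deterministic start. -/
theorem IsMarkovJumpProcess.integral_eq {E : Type*} [TopologicalSpace E] [CompactSpace E]
    [MeasurableSpace E] {G : C(E, ℝ) →L[ℝ] C(E, ℝ)} {ξ : E} {Ω : Type*} [MeasurableSpace Ω]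
    {P : Measure Ω} [IsProbabilityMeasure P] {Y : ℝ≥0 → Ω → E}
    (hY : IsMarkovJumpProcess G ξ P Y) (t : ℝ≥0) (f : C(E, ℝ)) :
    ∫ ω, f (Y t ω) ∂P = expGroup G t f ξ := by
  have hle : pastOf Y 0 ≤ ‹MeasurableSpace Ω› := iSup₂_le fun r _ => (hY.measurable r).comap_le
  have h1 := hY.markov 0 t f
  rw [zero_add] at h1
  rw [← integral_condExp hle, integral_congr_ae h1]
  have h2 : (fun ω => semigroupOf G t f (Y 0 ω)) =ᵐ[P] fun _ => semigroupOf G t f ξ := by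
    filter_upwards [hY.start] with ω hω
    rw [hω]
  rw [integral_congr_ae h2, integral_const]
  simp [semigroupOf, expGroup]

/-! ### Energies of the averaging process and of the random walk -/

variable {d N : ℕ} [NeZero N]

/-- The expected autocorrelation of the averaging process. -/
noncomputable def meanAutocorr (d N : ℕ) [NeZero N] (s : ℝ) (z : Torus d N) : ℝ :=
  expGroup (avgGenerator d N) s (autocorrMap z) (stdSimplex.vertex (0 : Torus d N))

theorem autocorr_single_zero (z : Torus d N) :
    autocorr (Pi.single (0 : Torus d N) (1 : ℝ)) z = if z = 0 then 1 else 0 := by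
  rw [autocorr, Finset.sum_eq_single (0 : Torus d N)
    (fun x _ hx => by rw [Pi.single_eq_of_ne hx, zero_mul]) (by simp)]
  simp [Pi.single_apply]

theorem meanAutocorr_zero_time (z : Torus d N) :
    meanAutocorr d N 0 z = if z = 0 then 1 else 0 := by
  rw [meanAutocorr, expGroup_zero]
  exact autocorr_single_zero z

theorem hasDerivAt_meanAutocorr (hN : 3 ≤ N) (s : ℝ) (z : Torus d N) :
    HasDerivAt (fun s => meanAutocorr d N s z) (torusLap (meanAutocorr d N s) z +
      1 / 2 * ∑ i, (meanAutocorr d N s 0 - meanAutocorr d N s (Pi.single i 1)) *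
      (2 * (if z = 0 then 1 else 0) - (if z = Pi.single i 1 then 1 else 0) -
        (if z = -Pi.single i 1 then 1 else 0))) s := by
  refine (hasDerivAt_expGroup_apply (avgGenerator d N) (autocorrMap z) _ s).congr_deriv ?_
  rw [avgGenerator_autocorrMap hN]
  simp only [map_add, map_sum, map_smul, map_sub, ContinuousMap.add_apply,
    ContinuousMap.smul_apply, ContinuousMap.sum_apply, ContinuousMap.sub_apply, smul_eq_mul,
    torusLap, meanAutocorr]
  congr 2
  exact Finset.sum_congr rfl fun i _ => mul_comm _ _

theorem continuous_meanAutocorr (hN : 3 ≤ N) (z : Torus d N) :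
    Continuous fun s => meanAutocorr d N s z :=
  continuous_iff_continuousAt.2 fun s => (hasDerivAt_meanAutocorr hN s z).continuousAt

theorem meanAutocorr_neg (s : ℝ) (z : Torus d N) :
    meanAutocorr d N s (-z) = meanAutocorr d N s z := by
  have : autocorrMap (-z) = autocorrMap z := by
    ext η
    exact autocorr_neg η.1 z
  rw [meanAutocorr, this, meanAutocorr]

/-- The normalized expected Dirichlet energy of the averaging process. -/
noncomputable def meanEnergy (d N : ℕ) [NeZero N] (s : ℝ) : ℝ :=
  1 / d * ∑ i, (meanAutocorr d N s 0 - meanAutocorr d N s (Pi.single i 1))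

theorem continuous_meanEnergy (hN : 3 ≤ N) : Continuous (meanEnergy d N) :=
  continuous_const.mul (continuous_finsetSum _ fun _ _ =>
    (continuous_meanAutocorr hN _).sub (continuous_meanAutocorr hN _))

/-- The expected energy of the averaging process solves a renewal equation. -/
theorem meanEnergy_renewal (hd : 1 ≤ d) (hN : 3 ≤ N) (t : ℝ) :
    meanEnergy d N t = decayProfile d N t +
      1 / 2 * ∫ s in (0 : ℝ)..t, decayRate d N s * meanEnergy d N (t - s) := by
  have hd' : (d : ℝ) ≠ 0 := by positivity
  have h1 := neg_torusLap_eq_decayProfile_add hd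
    (G := fun s i => meanAutocorr d N s 0 - meanAutocorr d N s (Pi.single i 1))
    (fun i => (continuous_meanAutocorr hN _).sub (continuous_meanAutocorr hN _))
    (hasDerivAt_meanAutocorr hN) meanAutocorr_zero_time t
  have h2 : ∀ s, ∑ i : Fin d, (meanAutocorr d N s 0 - meanAutocorr d N s (Pi.single i 1)) =
      d * meanEnergy d N s := by
    intro s
    rw [meanEnergy]
    field_simp
  have h3 : -torusLap (meanAutocorr d N t) 0 = 2 * (d * meanEnergy d N t) := by
    rw [← h2, torusLap, Finset.mul_sum, ← Finset.sum_neg_distrib]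
    refine Finset.sum_congr rfl fun i _ => ?_
    rw [zero_add, zero_sub, meanAutocorr_neg]
    ring
  rw [h3] at h1
  simp only [h2] at h1
  have h4 := intervalIntegral.integral_comp_sub_left (a := 0) (b := t)
    (fun s => decayRate d N s * meanEnergy d N (t - s)) t
  simp only [sub_sub_cancel, sub_self, sub_zero] at h4
  have h5 : ∫ s in (0 : ℝ)..t, decayRate d N (t - s) * (d * meanEnergy d N s) =
      d * ∫ s in (0 : ℝ)..t, decayRate d N (t - s) * meanEnergy d N s := by
    rw [← intervalIntegral.integral_const_mul]
    congr 1
    funext s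
    ring
  rw [h5, h4] at h1
  have h6 : 2 * (d : ℝ) * (meanEnergy d N t - (decayProfile d N t +
      1 / 2 * ∫ s in (0 : ℝ)..t, decayRate d N s * meanEnergy d N (t - s))) = 0 := by
    linear_combination h1
  have h7 := (mul_eq_zero.1 h6).resolve_left (by positivity)
  linarith

theorem integral_dirichletForm_averaging (hd : 1 ≤ d) (hN : 3 ≤ N) {Ω : Type*}
    [MeasurableSpace Ω] {P : Measure Ω} [IsProbabilityMeasure P] {η : ℝ≥0 → Ω → MassSpace d N}
    (hη : IsAveragingProcess d N P η) (t : ℝ≥0) :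
    ∫ ω, dirichletForm (fun x => η t ω x / unif d N x) ∂P =
      (N : ℝ) ^ d * (d * meanEnergy d N t) := by
  have hd' : (d : ℝ) ≠ 0 := by positivity
  have h1 := IsMarkovJumpProcess.integral_eq hη t
    ((N : ℝ) ^ d • ∑ i : Fin d, (autocorrMap 0 - autocorrMap (Pi.single i 1)))
  have h2 : ∀ ω, dirichletForm (fun x => η t ω x / unif d N x) =
      ((N : ℝ) ^ d • ∑ i : Fin d, (autocorrMap 0 - autocorrMap (Pi.single i 1)) :
        C(MassSpace d N, ℝ)) (η t ω) := by
    intro ω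
    rw [ContinuousMap.smul_apply, ContinuousMap.sum_apply]
    exact dirichletForm_div_unif hN (η t ω).1
  simp only [h2]
  rw [h1]
  simp only [map_sum, map_smul, map_sub, ContinuousMap.smul_apply, ContinuousMap.sum_apply,
    ContinuousMap.sub_apply, smul_eq_mul, meanEnergy, meanAutocorr]
  field_simp

theorem dirichletForm_nonneg (ψ : Torus d N → ℝ) : 0 ≤ dirichletForm ψ :=
  mul_nonneg (by positivity) (Finset.sum_nonneg fun _ _ => Finset.sum_nonneg fun _ _ => sq_nonneg _)

/-- The point indicator as a continuous function. -/
def pointMap (x : Torus d N) : C(Torus d N, ℝ) :=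
  ⟨fun y => if y = x then 1 else 0, continuous_of_discreteTopology⟩

/-- The law of the random walk at time `s`. -/
noncomputable def walkLaw (d N : ℕ) [NeZero N] (s : ℝ) (x : Torus d N) : ℝ :=
  expGroup (rwGenerator d N) s (pointMap x) 0

theorem rwGenerator_pointMap (hN : 3 ≤ N) (x : Torus d N) :
    rwGenerator d N (pointMap x) = (1 / 2 : ℝ) • ∑ i, (pointMap (x + Pi.single i 1) +
      pointMap (x - Pi.single i 1) - (2 : ℝ) • pointMap x) := by
  ext y
  rw [rwGenerator_apply, sum_adj hN]
  simp only [ContinuousMap.smul_apply, ContinuousMap.sum_apply, ContinuousMap.add_apply,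
    ContinuousMap.sub_apply, smul_eq_mul]
  congr 1
  refine Finset.sum_congr rfl fun i _ => ?_
  have e1 : y + Pi.single i 1 = x ↔ y = x - Pi.single i 1 := eq_sub_iff_add_eq.symm
  have e2 : y - Pi.single i 1 = x ↔ y = x + Pi.single i 1 := sub_eq_iff_eq_add
  simp only [pointMap, ContinuousMap.coe_mk, e1, e2]
  ring

theorem hasDerivAt_walkLaw (hN : 3 ≤ N) (s : ℝ) (x : Torus d N) :
    HasDerivAt (fun s => walkLaw d N s x) (1 / 2 * torusLap (walkLaw d N s) x) s := by
  refine (hasDerivAt_expGroup_apply (rwGenerator d N) (pointMap x) _ s).congr_deriv ?_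
  rw [rwGenerator_pointMap hN]
  simp only [map_add, map_sum, map_smul, map_sub, ContinuousMap.add_apply,
    ContinuousMap.smul_apply, ContinuousMap.sum_apply, ContinuousMap.sub_apply, smul_eq_mul,
    torusLap, walkLaw]

theorem torusLap_comp_add {d N : ℕ} (F : Torus d N → ℝ) (x z : Torus d N) :
    torusLap (fun x => F (x + z)) x = torusLap F (x + z) := by
  simp only [torusLap]
  refine Finset.sum_congr rfl fun i _ => ?_
  rw [add_right_comm x _ z, sub_add_eq_add_sub]

theorem torusLap_autocorr (F : Torus d N → ℝ) (z : Torus d N) :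
    torusLap (autocorr F) z = ∑ x, F x * torusLap F (x + z) := by
  simp only [torusLap, autocorr, Finset.mul_sum]
  rw [Finset.sum_comm (s := Finset.univ (α := Torus d N))]
  refine Finset.sum_congr rfl fun i _ => ?_
  rw [← Finset.sum_add_distrib, ← Finset.sum_sub_distrib]
  refine Finset.sum_congr rfl fun x _ => ?_
  rw [← add_assoc, ← add_sub_assoc]
  ring

theorem neg_torusLap_autocorr_walkLaw (hd : 1 ≤ d) (hN : 3 ≤ N) (t : ℝ) :
    -torusLap (autocorr (walkLaw d N t)) 0 = 2 * d * decayProfile d N t := by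
  -- Each of the two factors evolves with half the Laplacian, so their correlation evolves with the
  -- full one and no source.
  have h := neg_torusLap_eq_decayProfile_add (N := N) hd (Q := fun s => autocorr (walkLaw d N s))
    (G := fun _ _ => 0) (fun _ => continuous_const) (fun s z => ?_) (fun z => ?_) t
  · simpa using h
  · have h1 : ∀ x ∈ Finset.univ, HasDerivAt (fun s => walkLaw d N s x * walkLaw d N s (x + z)) _ s :=
      fun x _ => (hasDerivAt_walkLaw hN s x).mul (hasDerivAt_walkLaw hN s (x + z))
    refine (HasDerivAt.fun_sum h1).congr_deriv ?_
    have h2 := sum_torusLap_mul (walkLaw d N s) fun x => walkLaw d N s (x + z)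
    simp only [torusLap_comp_add] at h2
    simp only [zero_mul, Finset.sum_const_zero, mul_zero, add_zero, torusLap_autocorr]
    rw [Finset.sum_add_distrib]
    simp only [mul_assoc, mul_left_comm _ (1 / 2 : ℝ), ← Finset.mul_sum]
    rw [h2]
    ring
  · have h1 : walkLaw d N 0 = Pi.single (0 : Torus d N) (1 : ℝ) := by
      funext x
      rw [walkLaw, expGroup_zero]
      simp [pointMap, Pi.single_apply, eq_comm]
    simp only [h1]
    exact autocorr_single_zero z

theorem dirichletForm_randomWalk (hd : 1 ≤ d) (hN : 3 ≤ N) {Ω : Type*}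
    [MeasurableSpace Ω] {P : Measure Ω} [IsProbabilityMeasure P] {X : ℝ≥0 → Ω → Torus d N}
    (hX : IsRandomWalk d N P X) (t : ℝ≥0) :
    dirichletForm (fun x => P.real {ω | X t ω = x} / unif d N x) =
      (N : ℝ) ^ d * (d * decayProfile d N t) := by
  have h1 : ∀ x, P.real {ω | X t ω = x} = walkLaw d N t x := by
    intro x
    have hm : MeasurableSet {ω | X t ω = x} := hX.measurable t (measurableSet_singleton x)
    rw [walkLaw, ← IsMarkovJumpProcess.integral_eq hX t (pointMap x), ← integral_indicator_one hm]
    congr 1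
    funext ω
    simp [pointMap, Set.indicator_apply]
  simp only [h1]
  rw [dirichletForm_div_unif hN]
  have h2 := neg_torusLap_autocorr_walkLaw (N := N) hd hN t
  rw [torusLap_autocorr_zero] at h2
  congr 1
  linarith

end Semigroup

theorem theorem1 (d : ℕ) (hd : 1 ≤ d) :
    ∃ B C₁ C₂ : ℝ, 0 < B ∧ 0 < C₁ ∧ 0 < C₂ ∧
      ∃ N₀ : ℕ, ∀ (N : ℕ) [NeZero N], N₀ ≤ N →
        ∀ {Ω : Type*} [MeasurableSpace Ω] (P : Measure Ω) [IsProbabilityMeasure P]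
          (η : ℝ≥0 → Ω → MassSpace d N), IsAveragingProcess d N P η →
        ∀ {Ω' : Type*} [MeasurableSpace Ω'] (P' : Measure Ω') [IsProbabilityMeasure P']
          (X : ℝ≥0 → Ω' → Torus d N), IsRandomWalk d N P' X →
        ∀ t : ℝ≥0,
          (1 + C₁ * min (t : ℝ) 1) *
              dirichletForm (fun x => P'.real {ω | X t ω = x} / unif d N x)
            ≤ ∫ ω, dirichletForm (fun x => η t ω x / unif d N x) ∂P ∧
          ∫ ω, dirichletForm (fun x => η t ω x / unif d N x) ∂P
            ≤ C₂ * Real.exp (B * t / (N : ℝ) ^ (d + 2)) *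
              dirichletForm (fun x => P'.real {ω | X t ω = x} / unif d N x) := by
  obtain ⟨B, C₁, C₂, hB, hC₁, hC₂, N₀, hmain⟩ := exists_renewal_comparison hd
  refine ⟨B, C₁, C₂, hB, hC₁, hC₂, max N₀ 3,
    fun N _ hN Ω _ P _ η hη Ω' _ P' _ X hX t => ?_⟩
  have hN3 : 3 ≤ N := (le_max_right _ _).trans hN
  have hNp := natCast_pos_of_neZero (N := N)
  have hd' : (0 : ℝ) < d := by positivity
  have hpos : 0 < (N : ℝ) ^ d * d := by positivity
  -- Positivity comes from the process: at times `s ≥ 0` the quantity is, up to a positive factor,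
  -- the expectation of a Dirichlet form.
  have hnonneg : ∀ s : ℝ, 0 ≤ s → 0 ≤ meanEnergy d N s := by
    intro s hs
    have h1 := integral_dirichletForm_averaging hd hN3 hη ⟨s, hs⟩
    have h2 : 0 ≤ ∫ ω, dirichletForm (fun x => η ⟨s, hs⟩ ω x / unif d N x) ∂P :=
      integral_nonneg fun ω => dirichletForm_nonneg _
    rw [h1, ← mul_assoc] at h2
    exact nonneg_of_mul_nonneg_right h2 hpos
  obtain ⟨hlow, hupp⟩ := hmain N ((le_max_left _ _).trans hN) (meanEnergy d N)
    (continuous_meanEnergy hN3) hnonneg (fun t _ => meanEnergy_renewal hd hN3 t) t t.2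
  rw [integral_dirichletForm_averaging hd hN3 hη, dirichletForm_randomWalk hd hN3 hX]
  constructor
  · have := mul_le_mul_of_nonneg_left hlow hpos.le
    linarith
  · have := mul_le_mul_of_nonneg_left hupp hpos.le
    linarith
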